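/- Let $\kappa$ be an inaccessible cardinal (uncountable, regular, strong limit). For a set $A$ let ${}^{\mathrm{Succ}(<\kappa)}A$ be the set of sequences of elements of $A$ whose length is a successor ordinal $<\kappa$; for such $s$ write $\gamma(s)=\mathrm{lh}(s)-1$. Let $\mathcal L=\{\preceq\}$ with $\preceq$ binary. The logic $\mathcal L_{\kappa^+\kappa}$ allows conjunctions and disjunctions of $\le\kappa$ formulas (with $<\kappa$ free variables in total) and quantification over $<\kappa$ variables; for a sentence $\varphi$, $\mathrm{Mod}^\kappa_\varphi$ is the set of $\mathcal L$-structures with domain $\kappa$ satisfying $\varphi$. Write $x\prec y$ for $x\preceq y\wedge x\ne y$, and $x\perp y$ for $x\not\preceq y\wedge y\not\preceq x$. **Choices.** Let $\mathrm{Hes}_2$ be the Hessenberg (Gödel) pairing function of ordinals and $\theta(i,\gamma,\alpha)=1+2\cdot \mathrm{Hes}_2(\gamma,\alpha)+i$ for $i\in\{0,1\}$, $\gamma,\alpha<\kappa$. Fix a map $\#:{}^{\mathrm{Succ}(<\kappa)}\kappa\to\kappa$ whose restriction to ${}^{\gamma+1}\kappa$ is a bijection onto $\kappa$ for every $\gamma<\kappa$.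 Fix linear orders $L_\gamma=(\kappa,\preceq^{L_\gamma})$, $\gamma<\kappa$, without greatest element, such that $L_\gamma$ does not embed into $L_{\gamma'}$ for $\gamma\neq\gamma'$. Put $\mu(\gamma)=(\max\{\omega_1,|\gamma+1|,\sup_{\alpha<\gamma}\mu(\alpha)\})^+$, and for each $\gamma<\kappa$ and $u\in{}^{\gamma+1}2$ fix a linear order $L^*_u$ of size $\mu(\gamma)$ that is not a well-order, such that $L^*_u$ does not embed into $L^*_v$ for distinct $u,v\in{}^{\gamma+1}2$. (Such choices exist.) **Labels.** For a linear order $A$ and $n\in\omega$, let $A[n]$ be $A$, followed by $\omega$ with the reverse order, followed by $n$ pairwise incomparable triples $x,x^+,x^-$ with $x\preceq x^+$, $x\preceq x^-$ as the only nontrivial relations (every point of a part is below every point of a later part). The label of type II for $s\in{}^{\mathrm{Succ}(<\kappa)}\kappa$ is $\mathcal L_s=\theta(1,\gamma(s),\#s)[3]$; the label of type III for $u\in{}^{\mathrm{Succ}(<\kappa)}2$ is $\mathcal L^*_u=L^*_u[2]$. **Formulas.** For a structure $A$, $\tau_A(\langle x_i\rangle_{i\in A})$ is its quantifier-free type: the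 $x_i$ are distinct, and $x_i\preceq x_j$ iff $i\preceq^A j$. Let: - $\mathsf{Seq}(x)$: there is no $\langle x_n\rangle_{n<\omega}$ with $x_n\preceq x$ and $x_m\prec x_n$ for all $n<m$. - $\mathsf{Root}(x,y)$: $\mathsf{Seq}(x)\wedge\neg\mathsf{Seq}(y)\wedge x\preceq y\wedge\neg\exists w\,(x\prec w\preceq y\wedge\mathsf{Seq}(w))$. - $\mathsf{Stem}(x,\langle x_z\rangle_{z\in\mathbb Z})$: $\tau_{\mathbb Z}(\langle x_z\rangle)\wedge\bigwedge_z\mathsf{Root}(x,x_z)\wedge\forall y\,[\mathsf{Root}(x,y)\Rightarrow(\bigvee_z y=x_z\vee\bigwedge_z x_z\prec y)]$; $\mathsf{Stem}^\in(x,y)$: $y$ is an entry of some $\langle x_z\rangle$ with $\mathsf{Stem}(x,\langle x_z\rangle)$. - For $A=\mathcal L_s$ or $A=\mathcal L^*_u$, $\mathsf{Lab}_A(x,\langle x_i\rangle_{i\in A})$: $\tau_A(\langle x_i\rangle)$, and $\mathsf{Root}(x,x_i)\wedge\neg\mathsf{Stem}^\in(x,x_i)$ for all $i$, and every $y$ with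 $\mathsf{Root}(x,y)\wedge\neg\mathsf{Stem}^\in(x,y)$ comparable with some $x_i$ equals some $x_j$. $\mathsf{Lab}_A^\in(x,y)$: $y$ is an entry of some $\langle x_i\rangle$ with $\mathsf{Lab}_A(x,\langle x_i\rangle)$. $\mathsf{Seq}_s(x)$: $\exists\langle x_i\rangle\,\mathsf{Lab}_{\mathcal L_s}(x,\langle x_i\rangle)$. - $\mathsf{Lab}_{\mathrm I}^\in(x,y)$: $\mathsf{Root}(x,y)\wedge\neg\mathsf{Stem}^\in(x,y)\wedge\bigwedge_s\neg\mathsf{Lab}^\in_{\mathcal L_s}(x,y)\wedge\bigwedge_u\neg\mathsf{Lab}^\in_{\mathcal L^*_u}(x,y)$. $\mathsf{Fork}(y)$: $\exists w,w'\,(y\preceq w\wedge y\preceq w'\wedge w\perp w')$. - For $0<\alpha<\kappa$, $\mathsf{Lab}_{\mathrm I}^{\alpha}(x,y,\langle z_i\rangle_{i<\alpha})$: $\mathsf{Lab}_{\mathrm I}^\in(x,y)$, $\mathsf{Fork}(y)$, all $y\prec z_i$, $\tau_{(\alpha,\le)}(\langle z_i\rangle)$, and every $w\succ y$ comparable with some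 $z_i$ equals some $z_j$. $\mathsf{Lab}_{\mathrm I}^{=\alpha}(x,y)$: $\exists\langle z_i\rangle_{i<\alpha}\,\mathsf{Lab}_{\mathrm I}^{\alpha}(x,y,\langle z_i\rangle)$. **The sentence** $\Psi$ is the conjunction of (with $s,t$ ranging over ${}^{\mathrm{Succ}(<\kappa)}\kappa$ and $u$ over ${}^{\mathrm{Succ}(<\kappa)}2$): - $\Phi_0$: $\preceq$ is a partial order in which the predecessors of every point are pairwise comparable. - $\Phi_1$: $\forall y\,[\mathsf{Seq}(y)\vee\exists x\,\mathsf{Root}(x,y)]$. - $\Phi_2$: $\forall x\,[\mathsf{Seq}(x)\Rightarrow\exists\langle x_z\rangle\,\mathsf{Stem}(x,\langle x_z\rangle)]$. - $\Phi_3$: for all $x,s,t$, any sequences $\langle x_i\rangle,\langle y_j\rangle$ with $\mathsf{Lab}_{\mathcal L_s}(x,\langle x_i\rangle)$ and $\mathsf{Lab}_{\mathcal L_t}(x,\langle y_j\rangle)$ have a common entry. - $\Phi_4$: for every $s$ there is exactly one $x$ with $\mathsf{Seq}_s(x)$; and $\forall x\,[\mathsf{Seq}(x)\Rightarrow\bigvee_s\mathsf{Seq}_s(x)]$.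 - $\Phi_5$: for all $x,y,s,t$ with $\mathsf{Seq}_s(x)\wedge\mathsf{Seq}_t(y)$: $x\preceq y$ if $s\subseteq t$, and $x\not\preceq y$ if $s\not\subseteq t$. - $\Phi_6$: for all $x,u$, any two sequences satisfying $\mathsf{Lab}_{\mathcal L^*_u}(x,\cdot)$ have a common entry. - $\Phi_7$: for all $x,y$ and $0<\alpha,\beta<\kappa$, any sequences satisfying $\mathsf{Lab}_{\mathrm I}^\alpha(x,y,\cdot)$ and $\mathsf{Lab}_{\mathrm I}^\beta(x,y,\cdot)$ have a common entry. - $\Phi_8$: if $\mathsf{Lab}_{\mathrm I}^\in(x,y)$, then $\mathsf{Fork}(y)$ or there are $z$, $0<\alpha<\kappa$ and $\langle w_i\rangle_{i<\alpha}$ with $\mathsf{Lab}_{\mathrm I}^\alpha(x,z,\langle w_i\rangle)$ and $y=w_i$ for some $i$. - $\Phi_9$: for all $x,s$ with $\mathsf{Seq}_s(x)$: for every $\alpha<\kappa$ there is exactly one $y$ with $\mathsf{Lab}_{\mathrm I}^{=\theta(0,\gamma(s),\alpha)}(x,y)$; and every $y$ with $\mathsf{Lab}_{\mathrm I}^\in(x,y)\wedge\mathsf{Fork}(y)$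 satisfies $\mathsf{Lab}_{\mathrm I}^{=\theta(0,\gamma(s),\alpha)}(x,y)$ for some $\alpha<\kappa$. - $\Phi_{10}$: for all $x,s$ with $\mathsf{Seq}_s(x)$, all $\alpha,\beta<\kappa$ and all $y,z$ with $\mathsf{Lab}_{\mathrm I}^{=\theta(0,\gamma(s),\alpha)}(x,y)$ and $\mathsf{Lab}_{\mathrm I}^{=\theta(0,\gamma(s),\beta)}(x,z)$: $y\preceq z$ if $\alpha\preceq^{L_{\gamma(s)}}\beta$, and $y\not\preceq z$ otherwise. Let $\chi={}^{\mathrm{Succ}(<\kappa)}2\times{}^{\mathrm{Succ}(<\kappa)}\kappa$ and define $h:\mathrm{Mod}^\kappa_\Psi\to{}^{\chi}2$ by $$h(X)(u,s)=1\iff X\models\forall x\,[\mathsf{Seq}_s(x)\Rightarrow\exists\langle x_i\rangle_{i\in\mathcal L^*_u}\,\mathsf{Lab}_{\mathcal L^*_u}(x,\langle x_i\rangle)].$$ **Proposition.** The map $h$ reduces isomorphism on $\mathrm{Mod}^\kappa_\Psi$ to equality on ${}^\chi2$: for all $X,Y\in\mathrm{Mod}^\kappa_\Psi$, $X\cong Y\iff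 h(X)=h(Y)$. In particular the isomorphism relation on $\mathrm{Mod}^\kappa_\Psi$ is smooth, i.e. there is a map $h:\mathrm{Mod}^\kappa_\Psi\to{}^\chi 2$ with this property. -/

import Mathlib

open Cardinal Ordinal

universe u

noncomputable section

namespace GenTree

/-! ### Ordinals below `κ` and sequences of successor length -/

/-- The cardinal `κ`, seen as the set of ordinals below it. -/
abbrev K (κ : Cardinal.{u}) : Type u := κ.ord.ToType

/-- Sequences from `A` of successor length `γ + 1 < κ`. The domain `γ + 1` is `{α | α ≤ γ}`; as `κ`
is a limit ordinal, `γ + 1 < κ` says the same as `γ < κ`. -/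
structure SuccSeq (κ : Cardinal.{u}) (A : Type u) : Type u where
  /-- the last element of the domain: the length of the sequence is `top + 1` -/
  top : K κ
  /-- the values of the sequence -/
  val : Set.Iic top → A

/-- `s` is an initial segment of `t`. -/
def SuccSeq.IsPrefix {κ : Cardinal.{u}} {A : Type u} (s t : SuccSeq κ A) : Prop :=
  ∃ h : s.top ≤ t.top, ∀ α : Set.Iic s.top, t.val ⟨α.1, le_trans α.2 h⟩ = s.val α

/-- The set `2` (in the universe of `κ`). -/
abbrev Two : Type u := ULift.{u} Bool

/-! ### The logic `L_{κ⁺κ}` of one binary relation symbol -/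

/-- `W` has cardinality `< κ`. -/
class IsShort (κ : Cardinal.{u}) (W : Type u) : Prop where
  lt : #W < κ

/-- `J` has cardinality `≤ κ`. -/
class IsSmall (κ : Cardinal.{u}) (J : Type u) : Prop where
  le : #J ≤ κ

/-- Formulas of `L_{κ⁺κ}` in one binary relation symbol `⪯` whose free variables are in `V`:
negation, conjunctions of at most `κ` formulas, and existential quantification over a sequence of
fewer than `κ` variables. Formulas are taken up to renaming of bound variables: the quantifier `ex W`
adds to the variables `V` in scope the new variables `W`. Since every quantifier adds fewer than `κ`
variables, each subformula of a sentence has fewer than `κ` free variables. -/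
inductive Formula (κ : Cardinal.{u}) : Type u → Type (u + 1)
  | eq {V : Type u} (x y : V) : Formula κ V
  | rel {V : Type u} (x y : V) : Formula κ V
  | neg {V : Type u} (φ : Formula κ V) : Formula κ V
  | conj {V : Type u} (J : Type u) [IsSmall κ J] (φ : J → Formula κ V) : Formula κ V
  | ex {V : Type u} (W : Type u) [IsShort κ W] (φ : Formula κ (V ⊕ W)) : Formula κ V

/-- Sentences: formulas without free variables. -/
abbrev Sentence (κ : Cardinal.{u}) : Type (u + 1) := Formula κ PEmpty.{u + 1}

/-- Satisfaction of a formula in the structure `(X, R)` under the assignment `v`. -/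
def Formula.Realize {κ : Cardinal.{u}} {X : Type u} (R : X → X → Prop) :
    {V : Type u} → Formula κ V → (V → X) → Prop
  | _, .eq x y, v => v x = v y
  | _, .rel x y, v => R (v x) (v y)
  | _, .neg φ, v => ¬ φ.Realize R v
  | _, @Formula.conj _ _ J _ φ, v => ∀ j : J, (φ j).Realize R v
  | _, @Formula.ex _ _ W _ φ, v => ∃ w : W → X, φ.Realize R (Sum.elim v w)

/-- `Mod^κ_φ`: the structures with domain `κ` which satisfy the sentence `φ`. -/
def Mod {κ : Cardinal.{u}} (φ : Sentence κ) : Set (K κ → K κ → Prop) :=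
  {R | φ.Realize R PEmpty.elim}

/-- Isomorphism of structures. -/
def Isom {X Y : Type u} (R : X → X → Prop) (S : Y → Y → Prop) : Prop := Nonempty (R ≃r S)

/-! ### Cardinality facts -/

section Sizes

theorem mk_Iio_lt_self {κ : Cardinal.{u}} (α : K κ) : #(Set.Iio α) < κ := by
  have h := mk_Iio_lt α (by rw [mk_ord_toType, type_toType])
  rwa [mk_ord_toType] at h

variable {κ : Cardinal.{u}} [hκ : Fact κ.IsInaccessible]

theorem aleph0_lt : ℵ₀ < κ := hκ.out.aleph0_lt

theorem aleph0_le : ℵ₀ ≤ κ := aleph0_lt.le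

instance (W : Type u) [IsShort κ W] : IsSmall κ W := ⟨(IsShort.lt (κ := κ)).le⟩

instance (J : Type u) [Countable J] : IsShort κ J := ⟨(mk_le_aleph0 (α := J)).trans_lt aleph0_lt⟩

instance : IsSmall κ (K κ) := ⟨(mk_ord_toType κ).le⟩

instance (J I : Type u) [IsSmall κ J] [IsSmall κ I] : IsSmall κ (J × I) :=
  ⟨by
    rw [mk_prod, Cardinal.lift_id, Cardinal.lift_id]
    exact (mul_le_mul' IsSmall.le IsSmall.le).trans (mul_eq_self aleph0_le).le⟩

instance (J : Type u) [IsSmall κ J] (p : J → Prop) : IsSmall κ {j // p j} :=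
  ⟨(mk_subtype_le p).trans IsSmall.le⟩

instance (α : K κ) : IsShort κ (Set.Iio α) := ⟨mk_Iio_lt_self α⟩

instance (α : K κ) : IsShort κ (Set.Iic α) :=
  ⟨by
    rw [← Set.Iio_insert]
    refine (mk_insert_le).trans_lt ?_
    exact add_lt_of_lt aleph0_le (mk_Iio_lt_self α) (one_lt_aleph0.trans aleph0_lt)⟩

theorem mk_fun_le (W : Type u) [hW : IsShort κ W] : #(W → K κ) ≤ κ := by
  have hb : ∀ f : W → K κ, ∃ β : K κ, ∀ w, f w ≤ β := by
    intro f
    have h1 : (⨆ w, ((ToType.toOrd (f w) : Set.Iio κ.ord) : Ordinal)) < κ.ord :=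
      Ordinal.iSup_lt_of_lt_cof (by rw [hκ.out.isRegular.cof_ord]; exact hW.lt) fun w => (ToType.toOrd (f w)).2
    refine ⟨ToType.mk ⟨_, h1⟩, fun w => ?_⟩
    rw [← OrderIso.symm_apply_le, ← Subtype.coe_le_coe]
    exact Ordinal.le_iSup (fun w => ((ToType.toOrd (f w) : Set.Iio κ.ord) : Ordinal)) w
  choose b hb using hb
  have hinj : Function.Injective (fun f : W → K κ =>
      (⟨b f, fun w => ⟨f w, hb f w⟩⟩ : Σ β : K κ, (W → Set.Iic β))) := by
    intro f g h
    have : ∀ p q : Σ β : K κ, (W → Set.Iic β), p = q → ∀ w, (p.2 w).1 = (q.2 w).1 := by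
      rintro p q rfl w; rfl
    funext w
    exact this _ _ h w
  refine (mk_le_of_injective hinj).trans ?_
  rw [mk_sigma]
  refine (sum_le_sum (g := fun _ => κ) _ fun β => ?_).trans ?_
  · have hI : #(Set.Iic β) < κ := IsShort.lt
    rw [← power_def]
    have hm : max ℵ₀ (max #(Set.Iic β) #W) < κ := max_lt aleph0_lt (max_lt hI hW.lt)
    calc #(Set.Iic β) ^ #W
        ≤ (2 ^ max ℵ₀ (max #(Set.Iic β) #W)) ^ max ℵ₀ (max #(Set.Iic β) #W) := by
          refine (power_le_power_right (c := #W)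
            (((le_max_left _ #W).trans (le_max_right ℵ₀ _)).trans (cantor _).le)).trans ?_
          exact power_le_power_left (power_ne_zero _ two_ne_zero) ((le_max_right _ _).trans (le_max_right _ _))
      _ ≤ κ := by
          rw [← power_mul, mul_eq_self (le_max_left _ _)]
          exact (hκ.out.isStrongLimit.isStrongPrelimit hm).le
  · rw [sum_const', mk_ord_toType, mul_eq_self aleph0_le]

theorem isSmall_succSeq (A : Type u) (e : A ↪ K κ) : IsSmall κ (SuccSeq κ A) := by
  refine ⟨?_⟩
  have hinj : Function.Injective (fun s : SuccSeq κ A =>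
      (⟨s.top, fun α => e (s.val α)⟩ : Σ γ : K κ, (Set.Iic γ → K κ))) := by
    rintro ⟨a, f⟩ ⟨b, g⟩ h
    obtain ⟨rfl, h⟩ := Sigma.mk.inj_iff.1 h
    congr 1
    funext α
    exact e.injective (congrFun (eq_of_heq h) α)
  refine (mk_le_of_injective hinj).trans ?_
  rw [mk_sigma]
  refine (sum_le_sum (g := fun _ => κ) _ fun γ => mk_fun_le _).trans ?_
  rw [sum_const', mk_ord_toType, mul_eq_self aleph0_le]

instance : IsSmall κ (SuccSeq κ (K κ)) := isSmall_succSeq _ (Function.Embedding.refl _)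

instance : IsSmall κ (SuccSeq κ Two.{u}) := by
  refine isSmall_succSeq _ (Classical.choice ?_)
  rw [← le_def, mk_ord_toType]
  exact (IsShort.lt (κ := κ) (W := Two.{u})).le

end Sizes

/-! ### Derived connectives -/

namespace Formula

variable {κ : Cardinal.{u}} [hκ : Fact κ.IsInaccessible] {V : Type u}

def land (φ ψ : Formula κ V) : Formula κ V :=
  conj Two.{u} fun b => if b.down then φ else ψ

def lor (φ ψ : Formula κ V) : Formula κ V := neg (land (neg φ) (neg ψ))

def imp (φ ψ : Formula κ V) : Formula κ V := lor (neg φ) ψ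

def disj (J : Type u) [IsSmall κ J] (φ : J → Formula κ V) : Formula κ V :=
  neg (conj J fun j => neg (φ j))

def all (W : Type u) [IsShort κ W] (φ : Formula κ (V ⊕ W)) : Formula κ V := neg (ex W (neg φ))

/-- `x ≺ y` -/
def lt (x y : V) : Formula κ V := land (rel x y) (neg (eq x y))

/-- `x` and `y` are incomparable. -/
def perp (x y : V) : Formula κ V := land (neg (rel x y)) (neg (rel y x))

/-- `x` and `y` are comparable. -/
def comp (x y : V) : Formula κ V := lor (rel x y) (rel y x)

end Formula

/-- An index type with exactly `n` elements, for blocks of `n` variables. -/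
abbrev Vars (n : ℕ) : Type u := ULift.{u} (Fin n)

/-- The variable number `i` of the innermost block of `n` quantified variables. -/
abbrev bv {V : Type u} {n : ℕ} (i : Fin n) : V ⊕ Vars.{u} n := Sum.inr ⟨i⟩

/-- A variable `x` that was in scope before the innermost block of quantified variables. -/
abbrev up {V W : Type u} (x : V) : V ⊕ W := Sum.inl x

/-! ### The Hessenberg pairing function and the map `θ` -/

section Theta

variable {κ : Cardinal.{u}}

/-- The strict order on pairs of ordinals below `κ`: first compare the maxima, then
lexicographically. -/
def hesLT (p q : K κ × K κ) : Prop :=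
  max p.1 p.2 < max q.1 q.2 ∨
    (max p.1 p.2 = max q.1 q.2 ∧ (p.1 < q.1 ∨ (p.1 = q.1 ∧ p.2 < q.2)))

instance : IsWellOrder (K κ × K κ) hesLT := by
  let f : K κ × K κ → K κ × (K κ × K κ) := fun p => (max p.1 p.2, p)
  have hf : Function.Injective f := fun p q h => (Prod.mk.inj h).2
  let e : (hesLT (κ := κ)) ↪r
      (Prod.Lex (α := K κ) (β := K κ × K κ) (· < ·) (Prod.Lex (· < ·) (· < ·))) :=
    ⟨⟨f, hf⟩, by
      rintro ⟨a, b⟩ ⟨c, d⟩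
      simp [f, hesLT, Prod.lex_def]⟩
  exact e.isWellOrder

/-- The Hessenberg pairing `Hes₂(γ, α)` of two ordinals below `κ`: the position of `(γ, α)` in the
well-order `hesLT`. -/
def hes (γ α : K κ) : Ordinal.{u} := typein hesLT (γ, α)

/-- `θ(i, γ, α) = 1 + 2 · Hes₂(γ, α) + i`, for `i = 0, 1`. -/
def theta (i : Fin 2) (γ α : K κ) : Ordinal.{u} := 1 + 2 * hes γ α + (i : ℕ)

variable [hκ : Fact κ.IsInaccessible]

theorem card_hes_lt (γ α : K κ) : (hes γ α).card < κ := by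
  have h1 : (hes γ α).card = #{q : K κ × K κ // hesLT q (γ, α)} := card_typein (γ, α)
  rw [h1]
  have hq : ∀ q : {q : K κ × K κ // hesLT q (γ, α)}, max q.1.1 q.1.2 ≤ max γ α := by
    rintro ⟨q, h | h⟩
    exacts [h.le, h.1.le]
  have h2 : Function.Injective (fun q : {q : K κ × K κ // hesLT q (γ, α)} =>
      ((⟨q.1.1, (le_max_left _ _).trans (hq q)⟩, ⟨q.1.2, (le_max_right _ _).trans (hq q)⟩) :
        Set.Iic (max γ α) × Set.Iic (max γ α))) := by
    rintro ⟨⟨a, b⟩, h⟩ ⟨⟨c, d⟩, h'⟩ heq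
    have h1 := congrArg (fun x => (x.1.1, x.2.1)) heq
    exact Subtype.ext h1
  refine (mk_le_of_injective h2).trans_lt ?_
  rw [← mul_def]
  exact mul_lt_of_lt aleph0_le IsShort.lt IsShort.lt

instance (i : Fin 2) (γ α : K κ) : IsShort κ (theta i γ α).ToType :=
  ⟨by
    rw [mk_toType, theta, card_add, card_add, card_mul, card_nat, card_one]
    have hn : ∀ n : ℕ, (n : Cardinal.{u}) < κ := hκ.out.nat_lt
    refine add_lt_of_lt aleph0_le (add_lt_of_lt aleph0_le (by exact_mod_cast hn 1) ?_) (hn _)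
    exact mul_lt_of_lt aleph0_le (by simpa using hn 2) (card_hes_lt γ α)⟩

end Theta

/-! ### Labels of type II and III -/

/-- The points `x, x⁺, x⁻`. -/
inductive Prong
  | base
  | plus
  | minus

/-- The disjoint union of a set `A`, of `ω* = {n* | n ∈ ω}`, and of `n` triples `x, x⁺, x⁻`. -/
inductive LabelPt (A : Type u) (n : ℕ) : Type u
  | init (a : A)
  | star (m : ℕ)
  | prong (i : Fin n) (p : Prong)

/-- The order of a label with initial part `(A, r)`: first `A`, above it `ω` in the reverse order,
and above all of this the `n` pairwise incomparable triples, ordered by `x ⪯ x⁺, x⁻`. -/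
def labelLE {A : Type u} (r : A → A → Prop) {n : ℕ} : LabelPt A n → LabelPt A n → Prop
  | .init a, .init b => r a b
  | .init _, .star _ => True
  | .init _, .prong _ _ => True
  | .star k, .star m => m ≤ k
  | .star _, .prong _ _ => True
  | .prong i p, .prong j q => i = j ∧ (p = .base ∨ p = q)
  | _, _ => False

instance {κ : Cardinal.{u}} [hκ : Fact κ.IsInaccessible] (A : Type u) [hA : IsShort κ A] (n : ℕ) :
    IsShort κ (LabelPt A n) := by
  have : Countable Prong :=
    (Function.Injective.countable (f := fun p : Prong => match p with
      | .base => (0 : ℕ) | .plus => 1 | .minus => 2)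
      (by rintro (_ | _ | _) (_ | _ | _) h <;> simp_all))
  have hinj : Function.Injective (fun x : LabelPt A n => match x with
      | .init a => (Sum.inl a : A ⊕ ULift.{u} (ℕ ⊕ Fin n × Prong))
      | .star m => Sum.inr ⟨Sum.inl m⟩
      | .prong i p => Sum.inr ⟨Sum.inr (i, p)⟩) := by
    rintro (a | m | ⟨i, p⟩) (a | m | ⟨i, p⟩) h <;> simp_all
  refine ⟨(mk_le_of_injective hinj).trans_lt ?_⟩
  rw [mk_sum, Cardinal.lift_id, Cardinal.lift_id]
  exact add_lt_of_lt aleph0_le hA.lt IsShort.lt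

/-- `μ(γ) = (max {ω₁, |γ + 1|, sup {μ(α) | α < γ}})⁺`. -/
def mu {κ : Cardinal.{u}} (γ : K κ) : Cardinal.{u} :=
  Order.succ (max (max (ℵ_ 1) #(Set.Iic γ)) (⨆ α : Set.Iio γ, mu α.1))
termination_by γ
decreasing_by exact α.2

theorem mu_lt {κ : Cardinal.{u}} [hκ : Fact κ.IsInaccessible] (γ : K κ) : mu γ < κ := by
  induction γ using WellFoundedLT.induction with
  | ind γ ih =>
    have hl := hκ.out.isSuccLimit
    rw [mu]
    refine hl.succ_lt (max_lt (max_lt ?_ IsShort.lt) ?_)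
    · rw [← succ_aleph0]
      exact hl.succ_lt aleph0_lt
    · exact iSup_lt_of_isRegular hκ.out.isRegular IsShort.lt fun α => ih α.1 α.2

/-- The choices that enter in the definition of the labels: the enumeration `#` of the sequences
in `^{γ+1}κ` in type `κ`, for each `γ < κ`; the linear orders `L_γ = (κ, ⪯)`; and the linear orders
`L*_u` of size `μ(γ)`, for `u ∈ ^{γ+1}2`. -/
structure LabelChoice (κ : Cardinal.{u}) where
  /-- the map `#` -/
  hash : SuccSeq κ (K κ) → K κ
  hash_bijective : ∀ γ : K κ, Function.Bijective fun f : Set.Iic γ → K κ => hash ⟨γ, f⟩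
  /-- the order relation of `L_γ` -/
  L : K κ → K κ → K κ → Prop
  L_linear : ∀ γ, IsLinearOrder (K κ) (L γ)
  L_not_embeds : ∀ γ γ', γ ≠ γ' → IsEmpty (L γ ↪r L γ')
  L_no_greatest : ∀ γ a, ∃ b, b ≠ a ∧ L γ a b
  /-- the domain of `L*_u` -/
  Dom : SuccSeq κ Two.{u} → Type u
  /-- the order relation of `L*_u` -/
  LStar : ∀ u, Dom u → Dom u → Prop
  Dom_card : ∀ u, #(Dom u) = mu u.top
  LStar_linear : ∀ u, IsLinearOrder (Dom u) (LStar u)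
  LStar_not_embeds : ∀ u v, u.top = v.top → u ≠ v → IsEmpty (LStar u ↪r LStar v)
  LStar_not_wellOrder : ∀ u, ¬ WellFounded fun a b => LStar u a b ∧ a ≠ b

section Labels

variable {κ : Cardinal.{u}} (C : LabelChoice κ)

/-- The domain of the label of type II `𝓛_s`: its initial part is the ordinal `θ(1, γ, #s)`, where
`γ + 1` is the length of `s`. -/
abbrev DII (s : SuccSeq κ (K κ)) : Type u := LabelPt (theta 1 s.top (C.hash s)).ToType 3

/-- The order of the label of type II `𝓛_s`. -/
def leII (s : SuccSeq κ (K κ)) : DII C s → DII C s → Prop := labelLE (· ≤ ·)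

/-- The domain of the label of type III `𝓛*_u`. -/
abbrev DIII (u : SuccSeq κ Two.{u}) : Type u := LabelPt (C.Dom u) 2

/-- The order of the label of type III `𝓛*_u`. -/
def leIII (u : SuccSeq κ Two.{u}) : DIII C u → DIII C u → Prop := labelLE (C.LStar u)

instance [Fact κ.IsInaccessible] (u : SuccSeq κ Two.{u}) : IsShort κ (C.Dom u) :=
  ⟨(C.Dom_card u).trans_lt (mu_lt _)⟩

end Labels

/-! ### The formulas -/

open Formula

section Formulas

variable {κ : Cardinal.{u}} [hκ : Fact κ.IsInaccessible] {V : Type u}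

/-- The quantifier free type of the structure `(A, r)`, in the variables `z`. -/
def qfType {A : Type u} [IsSmall κ A] (r : A → A → Prop) (z : A → V) : Formula κ V :=
  land (conj {p : A × A // p.1 ≠ p.2} fun p => neg (eq (z p.1.1) (z p.1.2)))
    (land (conj {p : A × A // r p.1 p.2} fun p => rel (z p.1.1) (z p.1.2))
      (conj {p : A × A // ¬ r p.1 p.2} fun p => neg (rel (z p.1.1) (z p.1.2))))

/-- The axioms of trees. -/
def Phi0 : Sentence κ :=
  land (all (Vars 1) (rel (bv 0) (bv 0)))
  (land (all (Vars 2) (imp (land (rel (bv 0) (bv 1)) (rel (bv 1) (bv 0))) (eq (bv 0) (bv 1))))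
  (land (all (Vars 3) (imp (land (rel (bv 0) (bv 1)) (rel (bv 1) (bv 2))) (rel (bv 0) (bv 2))))
    (all (Vars 3) (imp (land (rel (bv 1) (bv 0)) (rel (bv 2) (bv 0))) (comp (bv 1) (bv 2))))))

/-- `Seq(x)`: there is no infinite descending sequence below `x`. -/
def Seq (x : V) : Formula κ V :=
  neg (ex (ULift.{u} ℕ) (conj {p : ULift.{u} ℕ × ULift.{u} ℕ // p.1.down < p.2.down} fun p =>
    land (rel (Sum.inr p.1.1) (up x)) (lt (Sum.inr p.1.2) (Sum.inr p.1.1))))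

/-- `Root(x, y)` -/
def Root (x y : V) : Formula κ V :=
  land (Seq x) (land (neg (Seq y)) (land (rel x y)
    (neg (ex (Vars 1) (land (lt (up x) (bv 0)) (land (rel (bv 0) (up y)) (Seq (bv 0))))))))

def Phi1 : Sentence κ :=
  all (Vars 1) (lor (Seq (bv 0)) (ex (Vars 1) (Root (bv 0) (up (bv 0)))))

/-- `Stem(x, ⟨x_z | z ∈ ℤ⟩)` -/
def Stem (x : V) (z : ULift.{u} ℤ → V) : Formula κ V :=
  land (qfType (fun i j : ULift.{u} ℤ => i.down ≤ j.down) z)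
  (land (conj (ULift.{u} ℤ) fun i => Root x (z i))
    (all (Vars 1) (imp (Root (up x) (bv 0))
      (lor (disj (ULift.{u} ℤ) fun i => eq (bv 0) (up (z i)))
        (conj (ULift.{u} ℤ) fun i => lt (up (z i)) (bv 0))))))

/-- `Stem^∈(x, y)` -/
def StemMem (x y : V) : Formula κ V :=
  ex (ULift.{u} ℤ) (land (Stem (up x) Sum.inr)
    (disj (ULift.{u} ℤ) fun i => eq (up y) (Sum.inr i)))

def Phi2 : Sentence κ :=
  all (Vars 1) (imp (Seq (bv 0)) (ex (ULift.{u} ℤ) (Stem (up (bv 0)) Sum.inr)))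

/-- The formula which says that `⟨z_i | i ∈ A⟩` is a copy of `(A, r)` made of points which have root
`x` and are not in the stem of `x`, and which contains all such points that are comparable with one
of the `z_i`. The formulas `Lab_s` and `Lab*_u` are its instances for the labels of type II and
III. -/
def Lab {A : Type u} [IsSmall κ A] (r : A → A → Prop) (x : V) (z : A → V) : Formula κ V :=
  land (qfType r z)
  (land (conj A fun i => land (Root x (z i)) (neg (StemMem x (z i))))
    (all (Vars 1) (imp
      (land (Root (up x) (bv 0)) (land (neg (StemMem (up x) (bv 0)))
        (disj A fun i => comp (up (z i)) (bv 0))))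
      (disj A fun i => eq (bv 0) (up (z i))))))

/-- `y` is one of the elements of a sequence `z` with `Lab r x z`. -/
def LabMem {A : Type u} [IsShort κ A] (r : A → A → Prop) (x y : V) : Formula κ V :=
  ex A (land (Lab r (up x) Sum.inr) (disj A fun i => eq (up y) (Sum.inr i)))

variable (C : LabelChoice κ)

/-- `Seq_s(x)` -/
def SeqAt (s : SuccSeq κ (K κ)) (x : V) : Formula κ V :=
  ex (DII C s) (Lab (leII C s) (up x) Sum.inr)

def Phi3 : Sentence κ :=
  all (Vars 1) (conj (SuccSeq κ (K κ) × SuccSeq κ (K κ)) fun p =>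
    all (DII C p.1) (all (DII C p.2)
      (imp (land (Lab (leII C p.1) (up (up (bv 0))) fun i => up (Sum.inr i))
          (Lab (leII C p.2) (up (up (bv 0))) fun j => Sum.inr j))
        (disj (DII C p.1 × DII C p.2) fun q => eq (up (Sum.inr q.1)) (Sum.inr q.2)))))

def Phi4 : Sentence κ :=
  land
    (conj (SuccSeq κ (K κ)) fun s =>
      ex (Vars 1) (land (SeqAt C s (bv 0))
        (all (Vars 1) (imp (SeqAt C s (bv 0)) (eq (bv 0) (up (bv 0)))))))
    (all (Vars 1) (imp (Seq (bv 0)) (disj (SuccSeq κ (K κ)) fun s => SeqAt C s (bv 0))))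

def Phi5 : Sentence κ :=
  all (Vars 2) (land
    (conj {p : SuccSeq κ (K κ) × SuccSeq κ (K κ) // p.1.IsPrefix p.2} fun p =>
      imp (land (SeqAt C p.1.1 (bv 0)) (SeqAt C p.1.2 (bv 1))) (rel (bv 0) (bv 1)))
    (conj {p : SuccSeq κ (K κ) × SuccSeq κ (K κ) // ¬ p.1.IsPrefix p.2} fun p =>
      imp (land (SeqAt C p.1.1 (bv 0)) (SeqAt C p.1.2 (bv 1))) (neg (rel (bv 0) (bv 1)))))

def Phi6 : Sentence κ :=
  all (Vars 1) (conj (SuccSeq κ Two.{u}) fun u =>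
    all (DIII C u) (all (DIII C u)
      (imp (land (Lab (leIII C u) (up (up (bv 0))) fun i => up (Sum.inr i))
          (Lab (leIII C u) (up (up (bv 0))) fun j => Sum.inr j))
        (disj (DIII C u × DIII C u) fun q => eq (up (Sum.inr q.1)) (Sum.inr q.2)))))

/-- `Lab_I^∈(x, y)`: the point `y` has root `x`, but is neither in the stem of `x` nor in one of the
labels of type II and III above it. -/
def LabIMem (x y : V) : Formula κ V :=
  land (Root x y) (land (neg (StemMem x y))
    (land (conj (SuccSeq κ (K κ)) fun s => neg (LabMem (leII C s) x y))
      (conj (SuccSeq κ Two.{u}) fun u => neg (LabMem (leIII C u) x y))))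

/-- There are two incomparable points above `y`. -/
def Fork (y : V) : Formula κ V :=
  ex (Vars 2) (land (rel (up y) (bv 0)) (land (rel (up y) (bv 1)) (perp (bv 0) (bv 1))))

/-- `Lab_I^A(x, y, ⟨z_i | i ∈ A⟩)`, for a (nonempty) ordinal `A`. -/
def LabI {A : Type u} [LE A] [IsSmall κ A] (x y : V) (z : A → V) : Formula κ V :=
  land (LabIMem C x y) (land (Fork y) (land (conj A fun i => lt y (z i))
  (land (qfType (fun i j : A => i ≤ j) z)
    (all (Vars 1) (imp
      (land (lt (up y) (bv 0)) (disj A fun i => comp (bv 0) (up (z i))))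
      (disj A fun i => eq (bv 0) (up (z i))))))))

/-- `Lab_I^{=A}(x, y)` -/
def LabIEq (A : Type u) [LE A] [IsShort κ A] (x y : V) : Formula κ V :=
  ex A (LabI C (up x) (up y) Sum.inr)

/-- The nonzero ordinals below `κ`. -/
abbrev PosK (κ : Cardinal.{u}) : Type u := {α : K κ // ∃ β, β < α}

def Phi7 : Sentence κ :=
  all (Vars 2) (conj (PosK κ × PosK κ) fun p =>
    all (Set.Iio p.1.1) (all (Set.Iio p.2.1)
      (imp (land (LabI C (up (up (bv 0))) (up (up (bv 1))) fun i : Set.Iio p.1.1 => up (Sum.inr i))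
          (LabI C (up (up (bv 0))) (up (up (bv 1))) fun j : Set.Iio p.2.1 => Sum.inr j))
        (disj (Set.Iio p.1.1 × Set.Iio p.2.1) fun q => eq (up (Sum.inr q.1)) (Sum.inr q.2)))))

def Phi8 : Sentence κ :=
  all (Vars 2) (imp (LabIMem C (bv 0) (bv 1)) (lor (Fork (bv 1))
    (ex (Vars 1) (disj (PosK κ) fun α => ex (Set.Iio α.1)
      (land (LabI C (up (up (bv 0))) (up (bv 0)) fun i : Set.Iio α.1 => Sum.inr i)
        (disj (Set.Iio α.1) fun i => eq (up (up (bv 1))) (Sum.inr i)))))))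

/-- `Lab_I^{=θ(0,γ,α)}(x, y)`. In the label of type I `𝓛_γ`, which consists of `L_γ` with a copy of
the nonzero ordinal `θ(0, γ, α)` appended above each point `α` of `L_γ`, the formula holds of the
point `α`. -/
def LabITheta (γ α : K κ) (x y : V) : Formula κ V := LabIEq C (theta 0 γ α).ToType x y

def Phi9 : Sentence κ :=
  all (Vars 1) (conj (SuccSeq κ (K κ)) fun s => imp (SeqAt C s (bv 0)) (land
    (conj (K κ) fun α => ex (Vars 1) (land (LabITheta C s.top α (up (bv 0)) (bv 0))
      (all (Vars 1) (imp (LabITheta C s.top α (up (up (bv 0))) (bv 0)) (eq (bv 0) (up (bv 0)))))))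
    (all (Vars 1) (imp (land (LabIMem C (up (bv 0)) (bv 0)) (Fork (bv 0)))
      (disj (K κ) fun α => LabITheta C s.top α (up (bv 0)) (bv 0))))))

def Phi10 : Sentence κ :=
  all (Vars 1) (conj (SuccSeq κ (K κ)) fun s => imp (SeqAt C s (bv 0)) (land
    (conj {p : K κ × K κ // C.L s.top p.1 p.2} fun p => all (Vars 2)
      (imp (land (LabITheta C s.top p.1.1 (up (bv 0)) (bv 0))
        (LabITheta C s.top p.1.2 (up (bv 0)) (bv 1))) (rel (bv 0) (bv 1))))
    (conj {p : K κ × K κ // ¬ C.L s.top p.1 p.2} fun p => all (Vars 2)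
      (imp (land (LabITheta C s.top p.1.1 (up (bv 0)) (bv 0))
        (LabITheta C s.top p.1.2 (up (bv 0)) (bv 1))) (neg (rel (bv 0) (bv 1)))))))

/-- The sentence `Ψ`. -/
def Psi : Sentence κ :=
  land Phi0 (land Phi1 (land Phi2 (land (Phi3 C) (land (Phi4 C) (land (Phi5 C) (land (Phi6 C)
    (land (Phi7 C) (land (Phi8 C) (land (Phi9 C) (Phi10 C))))))))))

/-- The sentence `∀ x [Seq_s(x) ⇒ ∃ ⟨x_i | i ∈ 𝓛*_u⟩ Lab*_u(x, ⟨x_i⟩)]`. -/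
def HasLabel (u : SuccSeq κ Two.{u}) (s : SuccSeq κ (K κ)) : Sentence κ :=
  all (Vars 1) (imp (SeqAt C s (bv 0))
    (ex (DIII C u) (Lab (leIII C u) (up (bv 0)) Sum.inr)))

open Classical in
/-- The map `h : Mod^κ_Ψ → ^χ2`, for `χ = ^{succ(<κ)}2 × ^{succ(<κ)}κ`. -/
def hMap (X : Mod (Psi C)) : SuccSeq κ Two.{u} × SuccSeq κ (K κ) → Bool :=
  fun p => decide ((HasLabel C p.1 p.2).Realize X.1 PEmpty.elim)

end Formulas

/-! ### Reductions -/

/-- `f` reduces the relation `R` to the relation `S`. -/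
def Reduces {X Y : Type*} (R : X → X → Prop) (S : Y → Y → Prop) (f : X → Y) : Prop :=
  ∀ x₀ x₁ : X, R x₀ x₁ ↔ S (f x₀) (f x₁)

/-- Isomorphism on `Mod^κ_φ`. -/
def IsomOn {κ : Cardinal.{u}} (φ : Sentence κ) (X Y : Mod φ) : Prop := Isom X.1 Y.1

/-- Isomorphism on `Mod^κ_φ` is smooth: it is reducible to equality on `^χ2`, for
`χ = ^{succ(<κ)}2 × ^{succ(<κ)}κ`. -/
def IsSmooth {κ : Cardinal.{u}} (φ : Sentence κ) : Prop :=
  ∃ h : Mod φ → (SuccSeq κ Two.{u} × SuccSeq κ (K κ) → Bool), Reduces (IsomOn φ) (· = ·) h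

end GenTree

end

namespace GenTree

open Formula

/-! ### Satisfaction of the derived connectives -/

section Realize

variable {κ : Cardinal.{u}} {V X : Type u} {R : X → X → Prop} {v : V → X}

/-! Isomorphic models have the same image under `hMap` because satisfaction is invariant under
isomorphism (`Formula.realize_relIso`). For the converse, a model of `Psi` is rebuilt from its image
alone: `Psi` pins down everything except which labels of type III stand above which sequence points.

By Φ4 and Φ5 the points satisfying `Seq` are indexed by the sequences `s`, ordered by initial
segment. By Φ1 every other point has a root, and the points with a given root form an upward closed
block (`isRoot_of_le`), so points of different blocks are incomparable. A `Seq` point lies below a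
point of a block exactly when it lies below the root (`le_iff_le_root`). It remains to determine one
block, with root at `s`. It starts with a stem, a copy of ℤ whose set of entries is unique
(`stem_eq`). Above the stem are the label of type II of `s`, at most one copy of each label of type
III, and a remainder of forks ordered like `C.L s.top`, with the chain `theta 0 s.top α` attached to
the fork numbered `α`.

These pieces do not interfere. A label contains every point of its block outside the stem that is
comparable with one of its entries, and it has an entry comparable with all the others. Hence two
labels with a comparable pair of entries have the same entries and are isomorphic
(`IsLab.nonempty_relIso`), while labels of type II and III, or of type III for distinct `u`, are
never isomorphic. A chain is separated from the forks because its points are not forks.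

So each model is isomorphic to the explicit tree `TreePt C P`, where `P` is read off from `hMap`
(`exists_locPt_embedding` for a block, `nonempty_relIso_treePt` for the tree). Models with equal
images are isomorphic to the same tree. -/

theorem Formula.realize_eq {x y : V} : (Formula.eq x y : Formula κ V).Realize R v ↔ v x = v y :=
  Iff.rfl

theorem Formula.realize_rel {x y : V} :
    (Formula.rel x y : Formula κ V).Realize R v ↔ R (v x) (v y) := Iff.rfl

theorem Formula.realize_neg {φ : Formula κ V} : (Formula.neg φ).Realize R v ↔ ¬ φ.Realize R v :=
  Iff.rfl

theorem Formula.realize_conj {J : Type u} [IsSmall κ J] {φ : J → Formula κ V} :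
    (Formula.conj J φ).Realize R v ↔ ∀ j, (φ j).Realize R v := Iff.rfl

theorem Formula.realize_ex {W : Type u} [IsShort κ W] {φ : Formula κ (V ⊕ W)} :
    (Formula.ex W φ).Realize R v ↔ ∃ w : W → X, φ.Realize R (Sum.elim v w) := Iff.rfl

/-- Satisfaction is invariant under isomorphisms. -/
theorem Formula.realize_relIso {Y : Type u} {S : Y → Y → Prop} (e : R ≃r S) (φ : Formula κ V)
    (v : V → X) : φ.Realize S (e ∘ v) ↔ φ.Realize R v := by
  induction φ with
  | eq x y => simp [realize_eq]
  | rel x y => simp [realize_rel, e.map_rel_iff]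
  | neg φ ih => rw [realize_neg, realize_neg, ih]
  | conj J φ ih =>
    rw [realize_conj, realize_conj]
    exact forall_congr' fun j => ih j v
  | ex W φ ih =>
    rw [realize_ex, realize_ex]
    constructor
    · rintro ⟨w, hw⟩
      refine ⟨e.symm ∘ w, (ih _).1 ?_⟩
      rw [Sum.comp_elim]
      simpa [Function.comp_def] using hw
    · rintro ⟨w, hw⟩
      refine ⟨e ∘ w, ?_⟩
      rw [← Sum.comp_elim]
      exact (ih _).2 hw

theorem Formula.realize_disj {J : Type u} [IsSmall κ J] {φ : J → Formula κ V} :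
    (disj J φ).Realize R v ↔ ∃ j, (φ j).Realize R v := by
  simp [disj, realize_neg, realize_conj]

theorem Formula.realize_all {W : Type u} [IsShort κ W] {φ : Formula κ (V ⊕ W)} :
    (all W φ).Realize R v ↔ ∀ w : W → X, φ.Realize R (Sum.elim v w) := by
  simp [all, realize_neg, realize_ex]

variable [hκ : Fact κ.IsInaccessible]

theorem Formula.realize_land {φ ψ : Formula κ V} :
    (land φ ψ).Realize R v ↔ φ.Realize R v ∧ ψ.Realize R v := by
  rw [land, realize_conj]
  constructor
  · intro h
    exact ⟨by simpa using h ⟨true⟩, by simpa using h ⟨false⟩⟩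
  · rintro ⟨h, h'⟩ ⟨_ | _⟩ <;> simpa

theorem Formula.realize_lor {φ ψ : Formula κ V} :
    (lor φ ψ).Realize R v ↔ φ.Realize R v ∨ ψ.Realize R v := by
  rw [lor, realize_neg, realize_land, realize_neg, realize_neg]
  tauto

theorem Formula.realize_imp {φ ψ : Formula κ V} :
    (imp φ ψ).Realize R v ↔ (φ.Realize R v → ψ.Realize R v) := by
  rw [imp, realize_lor, realize_neg]
  tauto

theorem Formula.realize_lt {x y : V} :
    (lt x y : Formula κ V).Realize R v ↔ R (v x) (v y) ∧ v x ≠ v y := by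
  rw [lt, realize_land, realize_neg, realize_rel, realize_eq]

theorem Formula.realize_perp {x y : V} :
    (perp x y : Formula κ V).Realize R v ↔ ¬ R (v x) (v y) ∧ ¬ R (v y) (v x) := by
  rw [perp, realize_land, realize_neg, realize_neg, realize_rel, realize_rel]

theorem Formula.realize_comp {x y : V} :
    (comp x y : Formula κ V).Realize R v ↔ R (v x) (v y) ∨ R (v y) (v x) := by
  rw [comp, realize_lor, realize_rel, realize_rel]

/-- A block of `n` quantified variables is a function on `Vars n`. This lemma and the five after it
trade such a block for ordinary quantifiers, so that formulas unfold to readable statements. -/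
theorem exists_vars_one {p : (Vars.{u} 1 → X) → Prop} : (∃ w, p w) ↔ ∃ x, p fun _ => x :=
  ⟨fun ⟨w, h⟩ => ⟨w ⟨0⟩, by
    convert h using 1
    funext ⟨i⟩
    rw [Subsingleton.elim i 0]⟩, fun ⟨_, h⟩ => ⟨_, h⟩⟩

theorem exists_vars_two {p : (Vars.{u} 2 → X) → Prop} :
    (∃ w, p w) ↔ ∃ x y, p fun i => ![x, y] i.down :=
  ⟨fun ⟨w, h⟩ => ⟨w ⟨0⟩, w ⟨1⟩, by
    convert h using 1
    funext ⟨i⟩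
    fin_cases i <;> rfl⟩, fun ⟨_, _, h⟩ => ⟨_, h⟩⟩

theorem exists_vars_three {p : (Vars.{u} 3 → X) → Prop} :
    (∃ w, p w) ↔ ∃ x y z, p fun i => ![x, y, z] i.down :=
  ⟨fun ⟨w, h⟩ => ⟨w ⟨0⟩, w ⟨1⟩, w ⟨2⟩, by
    convert h using 1
    funext ⟨i⟩
    fin_cases i <;> rfl⟩, fun ⟨_, _, _, h⟩ => ⟨_, h⟩⟩

theorem forall_vars_one {p : (Vars.{u} 1 → X) → Prop} : (∀ w, p w) ↔ ∀ x, p fun _ => x := by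
  simpa [not_iff_not] using not_congr (exists_vars_one (p := fun w => ¬ p w))

theorem forall_vars_two {p : (Vars.{u} 2 → X) → Prop} :
    (∀ w, p w) ↔ ∀ x y, p fun i => ![x, y] i.down := by
  simpa [not_iff_not] using not_congr (exists_vars_two (p := fun w => ¬ p w))

theorem forall_vars_three {p : (Vars.{u} 3 → X) → Prop} :
    (∀ w, p w) ↔ ∀ x y z, p fun i => ![x, y, z] i.down := by
  simpa [not_iff_not] using not_congr (exists_vars_three (p := fun w => ¬ p w))

end Realize

/-! ### The meaning of the formulas -/

section Semantics

variable {X : Type u} (R : X → X → Prop)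

/-- The meaning of `Seq`. -/
def IsSeq (x : X) : Prop :=
  ¬ ∃ w : ULift.{u} ℕ → X, ∀ m n, m.down < n.down → R (w m) x ∧ R (w n) (w m) ∧ w n ≠ w m

/-- The meaning of `Root`. -/
def IsRoot (x y : X) : Prop :=
  IsSeq R x ∧ ¬ IsSeq R y ∧ R x y ∧ ¬ ∃ w, (R x w ∧ x ≠ w) ∧ R w y ∧ IsSeq R w

/-- The meaning of `qfType`: `z` embeds `(A, r)` in `(X, R)`. -/
def IsCopy {A : Type u} (r : A → A → Prop) (z : A → X) : Prop :=
  Function.Injective z ∧ ∀ i j, R (z i) (z j) ↔ r i j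

/-- The meaning of `Stem`. -/
def IsStem (x : X) (z : ULift.{u} ℤ → X) : Prop :=
  IsCopy R (fun i j : ULift.{u} ℤ => i.down ≤ j.down) z ∧ (∀ i, IsRoot R x (z i)) ∧
    ∀ y, IsRoot R x y → (∃ i, y = z i) ∨ ∀ i, R (z i) y ∧ z i ≠ y

/-- The meaning of `StemMem`. -/
def InStem (x y : X) : Prop := ∃ z, IsStem R x z ∧ ∃ i, y = z i

/-- The meaning of `Lab`. -/
def IsLab {A : Type u} (r : A → A → Prop) (x : X) (z : A → X) : Prop :=
  IsCopy R r z ∧ (∀ i, IsRoot R x (z i) ∧ ¬ InStem R x (z i)) ∧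
    ∀ y, IsRoot R x y ∧ ¬ InStem R x y ∧ (∃ i, R (z i) y ∨ R y (z i)) → ∃ i, y = z i

/-- The meaning of `LabMem`. -/
def InLab {A : Type u} (r : A → A → Prop) (x y : X) : Prop := ∃ z, IsLab R r x z ∧ ∃ i, y = z i

/-- The meaning of `Fork`. -/
def IsFork (y : X) : Prop := ∃ w w', R y w ∧ R y w' ∧ ¬ R w w' ∧ ¬ R w' w

variable {κ : Cardinal.{u}} (C : LabelChoice κ)

/-- The meaning of `LabIMem`. -/
def InLabI (x y : X) : Prop :=
  IsRoot R x y ∧ ¬ InStem R x y ∧ (∀ s, ¬ InLab R (leII C s) x y) ∧ ∀ u, ¬ InLab R (leIII C u) x y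

/-- The meaning of `LabI`. -/
def IsLabI {A : Type u} [LE A] (x y : X) (z : A → X) : Prop :=
  InLabI R C x y ∧ IsFork R y ∧ (∀ i, R y (z i) ∧ y ≠ z i) ∧
    IsCopy R (fun i j : A => i ≤ j) z ∧
    ∀ w, (R y w ∧ y ≠ w) ∧ (∃ i, R w (z i) ∨ R (z i) w) → ∃ i, w = z i

/-- The meaning of `LabITheta`. -/
def IsLabITheta (γ α : K κ) (x y : X) : Prop :=
  ∃ z : (theta 0 γ α).ToType → X, IsLabI R C x y z

/-- The meaning of `SeqAt`. -/
def IsSeqAt (s : SuccSeq κ (K κ)) (x : X) : Prop := ∃ z, IsLab R (leII C s) x z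

/-- The models of `Ψ`, in semantic terms. -/
structure IsGenTree : Prop where
  refl : ∀ x, R x x
  antisymm : ∀ x y, R x y → R y x → x = y
  trans : ∀ x y z, R x y → R y z → R x z
  tree : ∀ x y z, R y x → R z x → R y z ∨ R z y
  exists_root : ∀ y, IsSeq R y ∨ ∃ x, IsRoot R x y
  exists_stem : ∀ x, IsSeq R x → ∃ z, IsStem R x z
  labII_meet : ∀ x s t, ∀ z w, IsLab R (leII C s) x z → IsLab R (leII C t) x w → ∃ i j, z i = w j
  exists_seqAt : ∀ s, ∃ x, IsSeqAt R C s x ∧ ∀ y, IsSeqAt R C s y → y = x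
  seqAt_of_seq : ∀ x, IsSeq R x → ∃ s, IsSeqAt R C s x
  seqAt_le_iff : ∀ x y s t, IsSeqAt R C s x → IsSeqAt R C t y → (R x y ↔ s.IsPrefix t)
  labIII_meet : ∀ x u, ∀ z w, IsLab R (leIII C u) x z → IsLab R (leIII C u) x w → ∃ i j, z i = w j
  labI_meet : ∀ x y, ∀ α β : PosK κ, ∀ (z : Set.Iio α.1 → X) (w : Set.Iio β.1 → X),
    IsLabI R C x y z → IsLabI R C x y w → ∃ i j, z i = w j
  fork_or_labI : ∀ x y, InLabI R C x y →
    IsFork R y ∨ ∃ z, ∃ α : PosK κ, ∃ w : Set.Iio α.1 → X, IsLabI R C x z w ∧ ∃ i, y = w i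
  exists_fork : ∀ x s, IsSeqAt R C s x → ∀ α, ∃ y, IsLabITheta R C s.top α x y ∧
    ∀ z, IsLabITheta R C s.top α x z → z = y
  theta_of_fork : ∀ x s, IsSeqAt R C s x → ∀ y, InLabI R C x y → IsFork R y →
    ∃ α, IsLabITheta R C s.top α x y
  fork_le_iff : ∀ x s, IsSeqAt R C s x → ∀ α β y z, IsLabITheta R C s.top α x y →
    IsLabITheta R C s.top β x z → (R y z ↔ C.L s.top α β)

variable {R} [hκ : Fact κ.IsInaccessible] {V : Type u} {v : V → X}

theorem realize_qfType {A : Type u} [IsSmall κ A] {r : A → A → Prop} {z : A → V} :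
    (qfType r z : Formula κ V).Realize R v ↔ IsCopy R r fun i => v (z i) := by
  simp only [qfType, IsCopy, realize_land, realize_conj, realize_neg, realize_eq, realize_rel,
    Subtype.forall, Prod.forall, Function.Injective]
  constructor
  · rintro ⟨h1, h2, h3⟩
    exact ⟨fun i j h => not_not.1 fun hn => h1 i j hn h, fun i j => ⟨fun h => not_not.1 fun hn => h3 i j hn h, h2 i j⟩⟩
  · rintro ⟨h1, h2⟩
    exact ⟨fun i j h h' => h (h1 h'), fun i j => (h2 i j).2, fun i j h h' => h ((h2 i j).1 h')⟩

theorem realize_Seq {x : V} : (Seq x : Formula κ V).Realize R v ↔ IsSeq R (v x) := by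
  simp [Seq, IsSeq, realize_land, realize_neg, realize_ex, realize_conj, realize_lt, realize_rel]

theorem realize_Root {x y : V} :
    (Root x y : Formula κ V).Realize R v ↔ IsRoot R (v x) (v y) := by
  simp only [Root, IsRoot, realize_land, realize_neg, realize_ex, realize_lt, realize_rel,
    realize_Seq, exists_vars_one, Sum.elim_inl, Sum.elim_inr]

theorem realize_Stem {x : V} {z : ULift.{u} ℤ → V} :
    (Stem x z : Formula κ V).Realize R v ↔ IsStem R (v x) fun i => v (z i) := by
  simp only [Stem, IsStem, realize_land, realize_conj, realize_qfType, realize_Root, realize_all,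
    realize_imp, realize_lor, realize_disj, realize_eq, realize_lt, forall_vars_one, Sum.elim_inl,
    Sum.elim_inr]

theorem realize_StemMem {x y : V} :
    (StemMem x y : Formula κ V).Realize R v ↔ InStem R (v x) (v y) := by
  simp only [StemMem, InStem, realize_land, realize_ex, realize_Stem, realize_disj, realize_eq,
    Sum.elim_inl, Sum.elim_inr]

theorem realize_Lab {A : Type u} [IsSmall κ A] {r : A → A → Prop} {x : V} {z : A → V} :
    (Lab r x z : Formula κ V).Realize R v ↔ IsLab R r (v x) fun i => v (z i) := by
  simp only [Lab, IsLab, realize_land, realize_conj, realize_qfType, realize_Root, realize_neg,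
    realize_StemMem, realize_all, realize_imp, realize_disj, realize_comp, realize_eq,
    forall_vars_one, Sum.elim_inl, Sum.elim_inr]

theorem realize_LabMem {A : Type u} [IsShort κ A] {r : A → A → Prop} {x y : V} :
    (LabMem r x y : Formula κ V).Realize R v ↔ InLab R r (v x) (v y) := by
  simp only [LabMem, InLab, realize_land, realize_ex, realize_Lab, realize_disj, realize_eq,
    Sum.elim_inl, Sum.elim_inr]

theorem realize_SeqAt {s : SuccSeq κ (K κ)} {x : V} :
    (SeqAt C s x).Realize R v ↔ IsSeqAt R C s (v x) := by
  simp only [SeqAt, IsSeqAt, realize_ex, realize_Lab, Sum.elim_inl, Sum.elim_inr]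

theorem realize_LabIMem {x y : V} :
    (LabIMem C x y).Realize R v ↔ InLabI R C (v x) (v y) := by
  simp only [LabIMem, InLabI, realize_land, realize_conj, realize_neg, realize_Root,
    realize_StemMem, realize_LabMem]

theorem realize_Fork {y : V} : (Fork y : Formula κ V).Realize R v ↔ IsFork R (v y) := by
  simp [Fork, IsFork, realize_land, realize_ex, realize_rel, realize_perp, exists_vars_two]

theorem realize_LabI {A : Type u} [LE A] [IsSmall κ A] {x y : V} {z : A → V} :
    (LabI C x y z).Realize R v ↔ IsLabI R C (v x) (v y) fun i => v (z i) := by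
  simp only [LabI, IsLabI, realize_land, realize_conj, realize_LabIMem, realize_Fork, realize_lt,
    realize_qfType, realize_all, realize_imp, realize_disj, realize_comp, realize_eq,
    forall_vars_one, Sum.elim_inl, Sum.elim_inr]

theorem realize_LabITheta {γ α : K κ} {x y : V} :
    (LabITheta C γ α x y).Realize R v ↔ IsLabITheta R C γ α (v x) (v y) := by
  simp only [LabITheta, LabIEq, IsLabITheta, realize_ex, realize_LabI, Sum.elim_inl, Sum.elim_inr]

theorem realize_HasLabel {v : PEmpty.{u + 1} → X} {u : SuccSeq κ Two.{u}} {s : SuccSeq κ (K κ)} :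
    (HasLabel C u s).Realize R v ↔ ∀ x, IsSeqAt R C s x → ∃ z, IsLab R (leIII C u) x z := by
  simp only [HasLabel, realize_all, realize_imp, realize_ex, realize_SeqAt, realize_Lab,
    forall_vars_one, Sum.elim_inl, Sum.elim_inr]

/-- Only this direction is needed, since the canonical tree is never required to satisfy `Psi`. Φ5
and Φ10 consist of two implications over complementary index sets; contraposing the negative one
merges them into an equivalence. -/
theorem isGenTree_of_realize {v : PEmpty.{u + 1} → X} (h : (Psi C).Realize R v) :
    IsGenTree R C := by
  simp only [Psi, realize_land] at h
  obtain ⟨h0, h1, h2, h3, h4, h5, h6, h7, h8, h9, h10⟩ := h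
  simp only [Phi0, realize_land, realize_all, realize_imp, realize_rel, realize_eq, realize_comp,
    forall_vars_one, forall_vars_two, forall_vars_three, Sum.elim_inr, Matrix.cons_val] at h0
  simp only [Phi1, realize_all, realize_lor, realize_ex, realize_Seq, realize_Root,
    forall_vars_one, exists_vars_one, Sum.elim_inl, Sum.elim_inr] at h1
  simp only [Phi2, realize_all, realize_imp, realize_ex, realize_Seq, realize_Stem,
    forall_vars_one, Sum.elim_inl, Sum.elim_inr] at h2
  simp only [Phi3, realize_all, realize_imp, realize_conj, realize_land, realize_disj, realize_Lab,
    realize_eq, forall_vars_one, Sum.elim_inl, Sum.elim_inr, Prod.forall, Prod.exists] at h3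
  simp only [Phi4, realize_all, realize_imp, realize_conj, realize_land, realize_disj, realize_ex,
    realize_SeqAt, realize_Seq, realize_eq, forall_vars_one, exists_vars_one, Sum.elim_inl,
    Sum.elim_inr] at h4
  simp only [Phi5, realize_all, realize_imp, realize_conj, realize_land, realize_neg,
    realize_SeqAt, realize_rel, forall_vars_two, Sum.elim_inr, Subtype.forall,
    Prod.forall, Matrix.cons_val] at h5
  simp only [Phi6, realize_all, realize_imp, realize_conj, realize_land, realize_disj, realize_Lab,
    realize_eq, forall_vars_one, Sum.elim_inl, Sum.elim_inr, Prod.exists] at h6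
  simp only [Phi7, realize_all, realize_imp, realize_conj, realize_land, realize_disj, realize_LabI,
    realize_eq, forall_vars_two, Sum.elim_inl, Sum.elim_inr, Prod.forall, Prod.exists,
    Matrix.cons_val] at h7
  simp only [Phi8, realize_all, realize_imp, realize_lor, realize_ex, realize_land, realize_disj,
    realize_LabI, realize_LabIMem, realize_Fork, realize_eq, forall_vars_two, exists_vars_one,
    Sum.elim_inl, Sum.elim_inr, Matrix.cons_val] at h8
  simp only [Phi9, realize_all, realize_imp, realize_conj, realize_ex, realize_land, realize_disj,
    realize_LabITheta, realize_SeqAt, realize_LabIMem, realize_Fork, realize_eq, forall_vars_one,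
    exists_vars_one, Sum.elim_inl, Sum.elim_inr] at h9
  simp only [Phi10, realize_all, realize_imp, realize_conj, realize_land, realize_neg,
    realize_LabITheta, realize_SeqAt, realize_rel, forall_vars_one, forall_vars_two,
    Sum.elim_inl, Sum.elim_inr, Subtype.forall, Prod.forall, Matrix.cons_val] at h10
  exact
    { refl := h0.1
      antisymm := fun x y a b => h0.2.1 x y ⟨a, b⟩
      trans := fun x y z a b => h0.2.2.1 x y z ⟨a, b⟩
      tree := fun x y z a b => h0.2.2.2 x y z ⟨a, b⟩
      exists_root := h1
      exists_stem := h2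
      labII_meet := fun x s t z w a b => h3 x s t z w ⟨a, b⟩
      exists_seqAt := h4.1
      seqAt_of_seq := h4.2
      seqAt_le_iff := fun x y s t a b =>
        ⟨fun h => not_not.1 fun hn => (h5 x y).2 s t hn ⟨a, b⟩ h, fun h => (h5 x y).1 s t h ⟨a, b⟩⟩
      labIII_meet := fun x u z w a b => h6 x u z w ⟨a, b⟩
      labI_meet := fun x y α β z w a b => h7 x y α β z w ⟨a, b⟩
      fork_or_labI := h8
      exists_fork := fun x s hs => (h9 x s hs).1
      theta_of_fork := fun x s hs y a b => (h9 x s hs).2 y ⟨a, b⟩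
      fork_le_iff := fun x s hs α β y z a b =>
        ⟨fun h => not_not.1 fun hn => (h10 x s hs).2 α β hn y z ⟨a, b⟩ h,
          fun h => (h10 x s hs).1 α β h y z ⟨a, b⟩⟩ }

end Semantics

/-! ### Copies closed under comparability -/

section Copies

variable {X A B : Type u} {R : X → X → Prop} {r : A → A → Prop} {r' : B → B → Prop}
  {z : A → X} {w : B → X}

/-- Comparability is not transitive, so one common point does not directly put all of `z` into `w`.
The point `c`, comparable with all of `A`, is the bridge: `z c` is comparable with the common point,
hence an entry of `w`, and every `z k` is comparable with `z c`. -/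
theorem IsCopy.exists_eq_of_meet {P : X → Prop} (hz : IsCopy R r z)
    (hc : ∃ c, ∀ i, r i c ∨ r c i) (hP : ∀ i, P (z i))
    (hw : ∀ y, P y → (∃ j, R (w j) y ∨ R y (w j)) → ∃ j, y = w j) {i : A} {j : B}
    (hij : z i = w j) (k : A) : ∃ l, z k = w l := by
  obtain ⟨c, hc⟩ := hc
  obtain ⟨l, hl⟩ := hw (z c) (hP c) ⟨j, by
    rw [← hij, hz.2, hz.2]
    exact hc i⟩
  exact hw (z k) (hP k) ⟨l, by
    rw [← hl, hz.2, hz.2]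
    exact (hc k).symm⟩

/-- Two copies with the same range induce the same order on it. -/
theorem IsCopy.nonempty_relIso (hz : IsCopy R r z) (hw : IsCopy R r' w)
    (h : ∀ i, ∃ j, z i = w j) (h' : ∀ j, ∃ i, w j = z i) : Nonempty (r ≃r r') := by
  choose f hf using h
  have hinj : Function.Injective f := fun i j hij => hz.1 (by rw [hf, hf, hij])
  let e : r ↪r r' := ⟨⟨f, hinj⟩, by
    intro i j
    change r' (f i) (f j) ↔ r i j
    rw [← hw.2, ← hf, ← hf, hz.2]⟩
  refine ⟨RelIso.ofSurjective e fun j => ?_⟩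
  obtain ⟨i, hi⟩ := h' j
  exact ⟨i, hw.1 (by rw [hi]; exact (hf i).symm)⟩

theorem IsLab.exists_eq {x : X} (hz : IsLab R r x z) (hw : IsLab R r' x w)
    (hc : ∃ c, ∀ i, r i c ∨ r c i) (h : ∃ i j, z i = w j) (k : A) : ∃ l, z k = w l := by
  obtain ⟨i, j, hij⟩ := h
  exact hz.1.exists_eq_of_meet (P := fun y => IsRoot R x y ∧ ¬ InStem R x y) hc hz.2.1
    (fun y hy h => hw.2.2 y ⟨hy.1, hy.2, h⟩) hij k

theorem IsLab.nonempty_relIso {x : X} (hz : IsLab R r x z) (hw : IsLab R r' x w)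
    (hc : ∃ c, ∀ i, r i c ∨ r c i) (hc' : ∃ c, ∀ i, r' i c ∨ r' c i) {i : A} {j : B}
    (hij : z i = w j) : Nonempty (r ≃r r') :=
  hz.1.nonempty_relIso hw.1 (hz.exists_eq hw hc ⟨i, j, hij⟩)
    (hw.exists_eq hz hc' ⟨j, i, hij.symm⟩)

end Copies

/-! ### Isomorphisms of labels -/

section LabelIso

variable {A B : Type u} {r : A → A → Prop} {r' : B → B → Prop} {n m : ℕ}

/-- The point `.star 0` is the greatest point of ω*, so the initial part and ω* lie below it and all
prongs above it. -/
theorem labelLE_star_zero (p : LabelPt A n) :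
    labelLE r p (.star 0) ∨ labelLE r (.star 0) p := by
  rcases p with a | k | ⟨i, p⟩ <;> simp [labelLE]

theorem exists_labelLE_comparable : ∃ c : LabelPt A n, ∀ p, labelLE r p c ∨ labelLE r c p :=
  ⟨.star 0, labelLE_star_zero⟩

instance : Finite Prong :=
  Finite.of_surjective (fun i : Fin 3 => ![Prong.base, Prong.plus, Prong.minus] i) fun p => by
    cases p
    exacts [⟨0, rfl⟩, ⟨1, rfl⟩, ⟨2, rfl⟩]

/-- The initial part of a label is definable as the set of points with infinitely many points above
them: a point of it has all of ω* above, whereas ω* is reversed and only finitely many prongs exist.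
The numbers of prongs play no role. -/
theorem finite_labelLE_star (k : ℕ) : {q : LabelPt A n | labelLE r (.star k) q}.Finite := by
  refine (((Set.finite_Iic k).image LabelPt.star).union
    (Set.finite_range fun p : Fin n × Prong => LabelPt.prong p.1 p.2)).subset ?_
  rintro (a | l | ⟨i, p⟩) h
  · exact h.elim
  · exact Or.inl ⟨l, h, rfl⟩
  · exact Or.inr ⟨(i, p), rfl⟩

theorem finite_labelLE_prong (i : Fin n) (p : Prong) :
    {q : LabelPt A n | labelLE r (.prong i p) q}.Finite := by
  refine (Set.finite_range fun p : Fin n × Prong => LabelPt.prong p.1 p.2).subset ?_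
  rintro (a | l | ⟨i, p⟩) h
  · exact h.elim
  · exact h.elim
  · exact ⟨(i, p), rfl⟩

theorem infinite_labelLE_init (a : A) : {q : LabelPt A n | labelLE r (.init a) q}.Infinite :=
  (Set.infinite_range_of_injective (f := fun k => (LabelPt.star k : LabelPt A n))
    fun k l h => by simpa using h).mono (by rintro _ ⟨k, rfl⟩; trivial)

theorem exists_init_of_infinite {p : LabelPt A n} (h : {q | labelLE r p q}.Infinite) :
    ∃ a, p = .init a := by
  rcases p with a | k | ⟨i, p⟩
  · exact ⟨a, rfl⟩
  · exact (h (finite_labelLE_star k)).elim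
  · exact (h (finite_labelLE_prong i p)).elim

theorem exists_init_of_relIso (e : (labelLE r : LabelPt A n → _ → Prop) ≃r
    (labelLE r' : LabelPt B m → _ → Prop)) (a : A) : ∃ b, e (.init a) = .init b := by
  refine exists_init_of_infinite (r := r') (Set.Infinite.mono ?_
    ((infinite_labelLE_init (r := r) (n := n) a).image e.injective.injOn))
  rintro _ ⟨q, hq, rfl⟩
  exact e.map_rel_iff.2 hq

/-- The initial part of a label is determined by the isomorphism type of the label. -/
theorem nonempty_relIso_of_labelLE (e : (labelLE r : LabelPt A n → _ → Prop) ≃r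
    (labelLE r' : LabelPt B m → _ → Prop)) : Nonempty (r ≃r r') :=
  IsCopy.nonempty_relIso (R := labelLE r') (z := fun a => e (.init a)) (w := LabelPt.init)
    ⟨fun a b h => by simpa using h, fun _ _ => e.map_rel_iff⟩
    ⟨fun a b h => by simpa using h, fun _ _ => Iff.rfl⟩ (exists_init_of_relIso e) fun b => by
      obtain ⟨a, ha⟩ := exists_init_of_relIso e.symm b
      exact ⟨a, by rw [← ha]; simp⟩

end LabelIso

/-! ### Non-isomorphism of distinct labels, and the ordinals θ as initial segments of κ -/

section Choice

variable {κ : Cardinal.{u}} (C : LabelChoice κ)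

/-- Each value is a successor cardinal of something at least as large as all earlier values. The
size of an order `C.LStar u` therefore reveals the length of `u`. -/
theorem mu_strictMono : StrictMono (mu : K κ → Cardinal.{u}) := by
  intro α γ h
  rw [mu.eq_1 γ, Order.lt_succ_iff]
  exact le_max_of_le_right
    (le_ciSup (f := fun α : Set.Iio γ => mu α.1) (bddAbove_of_small) ⟨α, h⟩)

/-- An isomorphism of labels restricts to the initial parts. Their cardinality gives the length of
the sequence, and among sequences of one length the chosen orders do not embed into each other. -/
theorem eq_of_leIII_relIso {u v : SuccSeq κ Two.{u}} (e : leIII C u ≃r leIII C v) : u = v := by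
  obtain ⟨e⟩ := nonempty_relIso_of_labelLE e
  have ht : u.top = v.top := mu_strictMono.injective (by
    rw [← C.Dom_card, ← C.Dom_card]
    exact mk_congr e.toEquiv)
  by_contra h
  exact (C.LStar_not_embeds u v ht h).false e.toRelEmbedding

/-- The initial part is an ordinal for type II and not a well-order for type III. -/
theorem isEmpty_leII_relIso_leIII (s : SuccSeq κ (K κ)) (u : SuccSeq κ Two.{u}) :
    IsEmpty (leII C s ≃r leIII C u) := by
  refine ⟨fun e => ?_⟩
  obtain ⟨e⟩ := nonempty_relIso_of_labelLE e
  refine C.LStar_not_wellOrder u ?_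
  refine Subrelation.wf (r := InvImage (· < ·) e.symm) ?_ (InvImage.wf _ wellFounded_lt)
  rintro a b ⟨hab, hne⟩
  exact lt_of_le_of_ne (e.symm.map_rel_iff.2 hab) fun h => hne (e.symm.injective h)

variable [Fact κ.IsInaccessible]

/-- Chains are indexed by `(theta 0 γ α).ToType` in Φ9 but by initial segments `Set.Iio δ` in Φ7 and
Φ8; this translates between the two. The summand 1 in `theta` makes the ordinal nonzero. -/
theorem exists_posK_orderIso_theta (γ α : K κ) :
    ∃ δ : PosK κ, Nonempty (Set.Iio δ.1 ≃o (theta 0 γ α).ToType) := by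
  have hlt : theta 0 γ α < κ.ord := by
    rw [lt_ord, ← mk_toType]
    exact IsShort.lt
  have hpos : 0 < theta 0 γ α := by
    rw [theta]
    exact zero_lt_one.trans_le (le_self_add.trans le_self_add)
  let δ : K κ := enum (α := K κ) (· < ·) ⟨theta 0 γ α, by simpa using hlt⟩
  have hδ : type (α := Set.Iio δ) (· < ·) = type (α := (theta 0 γ α).ToType) (· < ·) := by
    simpa [δ] using typein_enum (α := K κ) (· < ·) _
  obtain ⟨e⟩ := Ordinal.type_eq.1 hδ
  obtain ⟨i⟩ := nonempty_toType_iff.2 hpos.ne'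
  exact ⟨⟨δ, _, (e.symm i).2⟩, ⟨OrderIso.ofRelIsoLT e⟩⟩

end Choice

/-! ### The structure of the models -/

section Structure

variable {X : Type u} {R : X → X → Prop} {κ : Cardinal.{u}} {C : LabelChoice κ}

theorem IsSeqAt.isSeq {x : X} {s : SuccSeq κ (K κ)} (hs : IsSeqAt R C s x) : IsSeq R x := by
  obtain ⟨z, hz⟩ := hs
  exact (hz.2.1 (.star 0)).1.1

namespace IsGenTree

variable (hG : IsGenTree R C)
include hG

theorem isSeq_of_le {x y : X} (hy : IsSeq R y) (h : R x y) : IsSeq R x := fun ⟨w, hw⟩ =>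
  hy ⟨w, fun m n hmn => ⟨hG.trans _ _ _ (hw m n hmn).1 h, (hw m n hmn).2⟩⟩

/-- Both roots lie below `w`, so they are comparable. If they differed, the larger would be a `Seq`
point strictly above the smaller and below a point rooted there, or else `y` would lie below a `Seq`
point. -/
theorem root_eq_of_le {x x' y w : X} (hy : IsRoot R x y) (hw : IsRoot R x' w) (h : R y w) :
    x = x' := by
  by_contra hne
  rcases hG.tree w x x' (hG.trans _ _ _ hy.2.2.1 h) hw.2.2.1 with hxx | hxx
  · rcases hG.tree w x' y hw.2.2.1 h with h' | h'
    · exact hy.2.2.2 ⟨x', ⟨hxx, hne⟩, h', hw.1⟩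
    · exact hy.2.1 (hG.isSeq_of_le hw.1 h')
  · exact hw.2.2.2 ⟨x, ⟨hxx, Ne.symm hne⟩, hG.trans _ _ _ hy.2.2.1 h, hy.1⟩

theorem isRoot_of_le {x y w : X} (hy : IsRoot R x y) (h : R y w) : IsRoot R x w := by
  rcases hG.exists_root w with hw | ⟨x', hw⟩
  · exact (hy.2.1 (hG.isSeq_of_le hw h)).elim
  · rwa [hG.root_eq_of_le hy hw h]

theorem le_iff_le_root {x y w : X} (hw : IsSeq R w) (hy : IsRoot R x y) : R w y ↔ R w x := by
  refine ⟨fun h => ?_, fun h => hG.trans _ _ _ h hy.2.2.1⟩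
  rcases hG.tree y w x h hy.2.2.1 with h' | h'
  · exact h'
  · by_cases hxw : x = w
    · rw [hxw]
      exact hG.refl w
    · exact (hy.2.2.2 ⟨w, ⟨h', hxw⟩, h, hw⟩).elim

theorem not_root_le_seq {x y w : X} (hw : IsSeq R w) (hy : IsRoot R x y) : ¬ R y w := fun h =>
  hy.2.1 (hG.isSeq_of_le hw h)

/-- A point of `z` missing from `z'` lies above all of `z'`. Then `z'` has all its entries in `z`,
giving a strictly increasing map ℤ → ℤ that is bounded above, which is absurd. -/
theorem stem_eq {x : X} {z z' : ULift.{u} ℤ → X} (hz : IsStem R x z) (hz' : IsStem R x z')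
    (i : ULift.{u} ℤ) : ∃ j, z i = z' j := by
  by_contra hi
  have habove := (hz'.2.2 _ (hz.2.1 i)).resolve_left hi
  have hk : ∀ j, ∃ k, z' j = z k := fun j => (hz.2.2 _ (hz'.2.1 j)).resolve_right fun h =>
    (h i).2 (hG.antisymm _ _ (h i).1 (habove j).1)
  choose k hk using hk
  have hmono : ∀ a b : ℤ, (k ⟨a⟩).down ≤ (k ⟨b⟩).down ↔ a ≤ b := fun a b => by
    refine (hz.1.2 _ _).symm.trans ?_
    rw [← hk, ← hk, hz'.1.2]
  have hgrow : ∀ n : ℕ, (k ⟨0⟩).down + n ≤ (k ⟨n⟩).down := by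
    intro n
    induction n with
    | zero => simp
    | succ n ih =>
      have := (hmono (n + 1) n).not.2 (by omega)
      push_cast
      omega
  have hbdd : ∀ j, (k j).down ≤ i.down := fun j => by
    refine (hz.1.2 _ _).1 ?_
    rw [← hk]
    exact (habove j).1
  -- The argument is just large enough for the lower bound from `hgrow` to exceed the upper bound
  -- `i.down`.
  have h1 := hgrow (i.down - (k ⟨0⟩).down + 1).toNat
  have h2 := hbdd ⟨((i.down - (k ⟨0⟩).down + 1).toNat : ℕ)⟩
  have h3 := Int.self_le_toNat (i.down - (k ⟨0⟩).down + 1)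
  omega

theorem inStem_iff {x y : X} {z : ULift.{u} ℤ → X} (hz : IsStem R x z) :
    InStem R x y ↔ ∃ i, y = z i := by
  refine ⟨?_, fun h => ⟨z, hz, h⟩⟩
  rintro ⟨z', hz', i, rfl⟩
  exact hG.stem_eq hz' hz i

theorem stem_le {x y : X} {z : ULift.{u} ℤ → X} (hz : IsStem R x z) (hy : IsRoot R x y)
    (hn : ¬ InStem R x y) (i : ULift.{u} ℤ) : R (z i) y ∧ z i ≠ y :=
  (hz.2.2 y hy).resolve_left (fun h => hn ((hG.inStem_iff hz).2 h)) i

theorem not_inStem_of_le {x y w : X} (hy : IsRoot R x y) (hn : ¬ InStem R x y) (h : R y w) :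
    ¬ InStem R x w := by
  rintro ⟨z, hz, i, rfl⟩
  have := hG.stem_le hz hy hn i
  exact this.2 (hG.antisymm _ _ this.1 h)

/-- If `w` were in a label of type II or III, then `y`, being comparable with `w`, would be in it
too. -/
theorem inLabI_of_le {x y w : X} (hy : InLabI R C x y) (h : R y w) : InLabI R C x w := by
  refine ⟨hG.isRoot_of_le hy.1 h, hG.not_inStem_of_le hy.1 hy.2.1 h, fun s => ?_, fun u => ?_⟩
  · rintro ⟨z, hz, i, rfl⟩
    exact hy.2.2.1 s ⟨z, hz, hz.2.2 y ⟨hy.1, hy.2.1, i, Or.inr h⟩⟩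
  · rintro ⟨z, hz, i, rfl⟩
    exact hy.2.2.2 u ⟨z, hz, hz.2.2 y ⟨hy.1, hy.2.1, i, Or.inr h⟩⟩

/-- All points above an entry of the chain are again entries, hence pairwise comparable. -/
theorem not_isFork_of_isLabI {A : Type u} [LinearOrder A] {x y : X} {z : A → X}
    (hz : IsLabI R C x y z) (i : A) : ¬ IsFork R (z i) := by
  have key : ∀ a, R (z i) a → ∃ j, a = z j := fun a ha =>
    hz.2.2.2.2 a ⟨⟨hG.trans _ _ _ (hz.2.2.1 i).1 ha, by
      rintro rfl
      exact (hz.2.2.1 i).2 (hG.antisymm _ _ (hz.2.2.1 i).1 ha)⟩, i, Or.inr ha⟩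
  rintro ⟨a, b, ha, hb, hab, hba⟩
  obtain ⟨j, rfl⟩ := key a ha
  obtain ⟨k, rfl⟩ := key b hb
  rw [hz.2.2.2.1.2] at hab hba
  exact (le_total j k).elim hab hba

/-- Reflexivity at `x`, read through Φ5, makes each sequence an initial segment of the other. -/
theorem seqAt_unique {x : X} {s t : SuccSeq κ (K κ)} (hs : IsSeqAt R C s x)
    (ht : IsSeqAt R C t x) : s = t := by
  obtain ⟨h, hv⟩ := (hG.seqAt_le_iff x x s t hs ht).1 (hG.refl x)
  obtain ⟨h', -⟩ := (hG.seqAt_le_iff x x t s ht hs).1 (hG.refl x)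
  obtain ⟨a, f⟩ := s
  obtain ⟨b, g⟩ := t
  obtain rfl : a = b := le_antisymm h h'
  congr 1
  funext α
  exact (hv α).symm

end IsGenTree

end Structure

/-! ### The canonical model -/

section Canonical

variable {κ : Cardinal.{u}} (C : LabelChoice κ)

/-- The points with root `s` outside of the stem: the label of type II, the labels of type III
`𝓛*_u` for the `u` with `P u`, and the label of type I. -/
inductive LocPt (s : SuccSeq κ (K κ)) (P : SuccSeq κ Two.{u} → Prop) : Type u
  | labII (p : DII C s)
  | labIII (u : SuccSeq κ Two.{u}) (h : P u) (p : DIII C u)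
  | fork (α : K κ)
  | labI (α : K κ) (i : (theta 0 s.top α).ToType)

variable {C} in
/-- The order of `LocPt`. -/
inductive LocPt.Le {s : SuccSeq κ (K κ)} {P : SuccSeq κ Two.{u} → Prop} :
    LocPt C s P → LocPt C s P → Prop
  | labII {p q} : leII C s p q → Le (labII p) (labII q)
  | labIII {u h p q} : leIII C u p q → Le (labIII u h p) (labIII u h q)
  | fork {α β} : C.L s.top α β → Le (fork α) (fork β)
  | fork_labI {α β i} : C.L s.top α β → Le (fork α) (labI β i)
  | labI {α i j} : i ≤ j → Le (labI α i) (labI α j)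

/-- The model in which `s` has a label of type III `𝓛*_u` if and only if `P u s`. -/
inductive TreePt (P : SuccSeq κ Two.{u} → SuccSeq κ (K κ) → Prop) : Type u
  | seq (s : SuccSeq κ (K κ))
  | stem (s : SuccSeq κ (K κ)) (i : ULift.{u} ℤ)
  | loc (s : SuccSeq κ (K κ)) (p : LocPt C s fun u => P u s)

variable {C} in
/-- The order of `TreePt`. -/
inductive TreePt.Le {P : SuccSeq κ Two.{u} → SuccSeq κ (K κ) → Prop} :
    TreePt C P → TreePt C P → Prop
  | seq {s t} : s.IsPrefix t → Le (seq s) (seq t)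
  | seq_stem {s t i} : s.IsPrefix t → Le (seq s) (stem t i)
  | seq_loc {s t p} : s.IsPrefix t → Le (seq s) (loc t p)
  | stem {s i j} : i.down ≤ j.down → Le (stem s i) (stem s j)
  | stem_loc {s i p} : Le (stem s i) (loc s p)
  | loc {s p q} : LocPt.Le p q → Le (loc s p) (loc s q)

end Canonical

/-! ### Every model is isomorphic to its canonical tree -/

section Iso

variable {X : Type u} {R : X → X → Prop} {κ : Cardinal.{u}} {C : LabelChoice κ}

theorem IsLabI.comp_orderIso {A B : Type u} [LE A] [LE B] {x y : X} {z : A → X}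
    (hz : IsLabI R C x y z) (e : B ≃o A) : IsLabI R C x y fun i => z (e i) := by
  obtain ⟨h1, h2, h3, h4, h5⟩ := hz
  refine ⟨h1, h2, fun i => h3 _, ⟨fun i j h => e.injective (h4.1 h), fun i j => ?_⟩, ?_⟩
  · exact (h4.2 _ _).trans e.le_iff_le
  · rintro w ⟨hw, i, hi⟩
    obtain ⟨j, rfl⟩ := h5 w ⟨hw, e i, hi⟩
    exact ⟨e.symm j, by simp⟩

theorem IsLabI.exists_eq {A B : Type u} [LinearOrder A] [LE B] {x y : X} {z : A → X} {w : B → X}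
    (hz : IsLabI R C x y z) (hw : IsLabI R C x y w) (h : ∃ i j, z i = w j) (k : A) :
    ∃ l, z k = w l := by
  obtain ⟨i, j, hij⟩ := h
  exact hz.2.2.2.1.exists_eq_of_meet (P := fun a => R y a ∧ y ≠ a) ⟨i, fun k => le_total k i⟩
    hz.2.2.1 (fun a ha ⟨j, hj⟩ => hw.2.2.2.2 a ⟨ha, j, hj.symm⟩) hij k

namespace IsGenTree

variable [Fact κ.IsInaccessible] (hG : IsGenTree R C)
include hG

/-- This determines a block above its stem: each constructor of `LocPt` is sent to the piece
supplied by the axioms. The work is to show that no further order relations hold between the pieces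
and that the pieces exhaust the block. -/
theorem exists_locPt_embedding {s : SuccSeq κ (K κ)} {x : X} (hx : IsSeqAt R C s x)
    {P : SuccSeq κ Two.{u} → Prop} (hP : ∀ u, P u ↔ ∃ z, IsLab R (leIII C u) x z) :
    ∃ g : LocPt C s P → X, (∀ p, IsRoot R x (g p) ∧ ¬ InStem R x (g p)) ∧
      (∀ y, IsRoot R x y → ¬ InStem R x y → ∃ p, g p = y) ∧ IsCopy R LocPt.Le g := by
  obtain ⟨z₂, h₂⟩ := id hx
  choose z₃ h₃ using fun u => (hP u).1
  choose y hyW hyu using hG.exists_fork x s hx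
  choose W hW using hyW
  have := C.L_linear s.top
  have hL : ∀ α β, R (y α) (y β) ↔ C.L s.top α β := fun α β =>
    hG.fork_le_iff x s hx α β _ _ ⟨_, hW α⟩ ⟨_, hW β⟩
  have hyinj : ∀ α β, y α = y β → α = β := fun α β h =>
    antisymm_of (C.L s.top) ((hL α β).1 (h ▸ hG.refl _)) ((hL β α).1 (h ▸ hG.refl _))
  have hyI : ∀ α, InLabI R C x (y α) := fun α => (hW α).1
  have hyF : ∀ α, IsFork R (y α) := fun α => (hW α).2.1
  have hyWle : ∀ α i, R (y α) (W α i) := fun α i => ((hW α).2.2.1 i).1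
  have hWI : ∀ α i, InLabI R C x (W α i) := fun α i => hG.inLabI_of_le (hyI α) (hyWle α i)
  have hWF : ∀ α i, ¬ IsFork R (W α i) := fun α i => hG.not_isFork_of_isLabI (hW α) i
  -- The tool for separating forks from chains: a point strictly above `y α` and comparable with its
  -- chain belongs to the chain, so it cannot be a fork.
  have hclosed : ∀ α i v, R (y α) v → y α ≠ v → R v (W α i) ∨ R (W α i) v → ¬ IsFork R v := by
    intro α i v h1 h2 h3
    obtain ⟨j, rfl⟩ := (hW α).2.2.2.2 v ⟨⟨h1, h2⟩, i, h3⟩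
    exact hWF α j
  have hyWL : ∀ α β i, R (y α) (W β i) ↔ C.L s.top α β := by
    intro α β i
    rw [← hL]
    refine ⟨fun h => ?_, fun h => hG.trans _ _ _ h (hyWle β i)⟩
    rcases hG.tree _ _ _ h (hyWle β i) with h' | h'
    · exact h'
    · by_cases hne : y β = y α
      · exact hne ▸ hG.refl _
      · exact (hclosed β i _ h' hne (Or.inl h) (hyF α)).elim
  have hWy : ∀ α β i, ¬ R (W α i) (y β) := by
    intro α β i h
    refine hclosed α i (y β) (hG.trans _ _ _ (hyWle α i) h) (fun hne => ?_) (Or.inr h) (hyF β)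
    exact ((hW α).2.2.1 i).2 (hG.antisymm _ _ (hyWle α i) (hne ▸ h))
  -- The forks below two comparable chain points are comparable. If they are distinct, the upper one
  -- is comparable with the chain of the lower one, contradicting `hclosed`.
  have hWW : ∀ α β i j, R (W α i) (W β j) → α = β := by
    intro α β i j h
    by_contra hne
    rcases hG.tree _ _ _ (hG.trans _ _ _ (hyWle α i) h) (hyWle β j) with h' | h'
    · exact hclosed α i _ h' (fun he => hne (hyinj _ _ he)) (hG.tree _ _ _ (hyWle β j) h) (hyF β)
    · exact hclosed β j _ h' (fun he => hne (hyinj _ _ he).symm)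
        (Or.inl (hG.trans _ _ _ (hyWle α i) h)) (hyF α)
  have h23 : ∀ p u hu q, ¬ (R (z₂ p) (z₃ u hu q) ∨ R (z₃ u hu q) (z₂ p)) := by
    intro p u hu q h
    obtain ⟨j, hj⟩ := h₂.2.2 _ ⟨((h₃ u hu).2.1 q).1, ((h₃ u hu).2.1 q).2, p, h⟩
    obtain ⟨e⟩ := h₂.nonempty_relIso (h₃ u hu) exists_labelLE_comparable
      exists_labelLE_comparable hj.symm
    exact (isEmpty_leII_relIso_leIII C s u).false e
  have h33 : ∀ u hu p v hv q, R (z₃ u hu p) (z₃ v hv q) → u = v := by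
    intro u hu p v hv q h
    obtain ⟨j, hj⟩ := (h₃ u hu).2.2 _ ⟨((h₃ v hv).2.1 q).1, ((h₃ v hv).2.1 q).2, p, Or.inl h⟩
    obtain ⟨e⟩ := (h₃ u hu).nonempty_relIso (h₃ v hv) exists_labelLE_comparable
      exists_labelLE_comparable hj.symm
    exact eq_of_leIII_relIso C e
  have h2I : ∀ p v, InLabI R C x v → ¬ (R (z₂ p) v ∨ R v (z₂ p)) := fun p v hv h =>
    hv.2.2.1 s ⟨z₂, h₂, h₂.2.2 v ⟨hv.1, hv.2.1, p, h⟩⟩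
  have h3I : ∀ u hu p v, InLabI R C x v → ¬ (R (z₃ u hu p) v ∨ R v (z₃ u hu p)) :=
    fun u hu p v hv h => hv.2.2.2 u ⟨_, h₃ u hu, (h₃ u hu).2.2 v ⟨hv.1, hv.2.1, p, h⟩⟩
  let g : LocPt C s P → X := fun p => match p with
    | .labII p => z₂ p
    | .labIII u hu p => z₃ u hu p
    | .fork α => y α
    | .labI α i => W α i
  have hle : ∀ p q, R (g p) (g q) ↔ LocPt.Le p q := by
    intro p q
    constructor
    · intro h
      rcases p with p | ⟨u, hu, p⟩ | α | ⟨α, i⟩ <;> rcases q with q | ⟨v, hv, q⟩ | β | ⟨β, j⟩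
      · exact .labII ((h₂.1.2 _ _).1 h)
      · exact (h23 _ _ _ _ (.inl h)).elim
      · exact (h2I _ _ (hyI β) (.inl h)).elim
      · exact (h2I _ _ (hWI β j) (.inl h)).elim
      · exact (h23 _ _ _ _ (.inr h)).elim
      · obtain rfl := h33 _ _ _ _ _ _ h
        exact .labIII (((h₃ u hu).1.2 _ _).1 h)
      · exact (h3I _ _ _ _ (hyI β) (.inl h)).elim
      · exact (h3I _ _ _ _ (hWI β j) (.inl h)).elim
      · exact (h2I _ _ (hyI α) (.inr h)).elim
      · exact (h3I _ _ _ _ (hyI α) (.inr h)).elim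
      · exact .fork ((hL _ _).1 h)
      · exact .fork_labI ((hyWL _ _ _).1 h)
      · exact (h2I _ _ (hWI α i) (.inr h)).elim
      · exact (h3I _ _ _ _ (hWI α i) (.inr h)).elim
      · exact (hWy _ _ _ h).elim
      · obtain rfl := hWW _ _ _ _ h
        exact .labI (((hW α).2.2.2.1.2 _ _).1 h)
    · rintro (h | h | h | h | h)
      · exact (h₂.1.2 _ _).2 h
      · exact ((h₃ _ _).1.2 _ _).2 h
      · exact (hL _ _).2 h
      · exact (hyWL _ _ _).2 h
      · exact ((hW _).2.2.2.1.2 _ _).2 h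
  refine ⟨g, ?_, ?_, ?_, hle⟩
  · rintro (p | ⟨u, hu, p⟩ | α | ⟨α, i⟩)
    · exact h₂.2.1 p
    · exact (h₃ u hu).2.1 p
    · exact ⟨(hyI α).1, (hyI α).2.1⟩
    · exact ⟨(hWI α i).1, (hWI α i).2.1⟩
  · intro v hv hvS
    by_cases hII : ∃ t, InLab R (leII C t) x v
    · obtain ⟨t, z, hz, i, rfl⟩ := hII
      -- A copy of the label of `t` above `x` is already a witness of `Seq_t(x)`, so `t` is `s`.
      obtain rfl := hG.seqAt_unique hx ⟨z, hz⟩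
      obtain ⟨l, hl⟩ := hz.exists_eq h₂ exists_labelLE_comparable
        (hG.labII_meet x _ _ _ _ hz h₂) i
      exact ⟨.labII l, hl.symm⟩
    by_cases hIII : ∃ u, InLab R (leIII C u) x v
    · obtain ⟨u, z, hz, i, rfl⟩ := hIII
      have hu := (hP u).2 ⟨z, hz⟩
      obtain ⟨l, hl⟩ := hz.exists_eq (h₃ u hu) exists_labelLE_comparable
        (hG.labIII_meet x _ _ _ hz (h₃ u hu)) i
      exact ⟨.labIII u hu l, hl.symm⟩
    have hI : InLabI R C x v := ⟨hv, hvS, fun t ht => hII ⟨t, ht⟩, fun u hu => hIII ⟨u, hu⟩⟩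
    rcases hG.fork_or_labI x v hI with hF | ⟨a, δ, w, hw, i, rfl⟩
    · obtain ⟨α, hα⟩ := hG.theta_of_fork x s hx v hI hF
      exact ⟨.fork α, (hyu α v hα).symm⟩
    · obtain ⟨α, hα⟩ := hG.theta_of_fork x s hx a hw.1 hw.2.1
      obtain rfl := hyu α a hα
      -- Φ8 gives a chain of unknown length `δ` above the same fork. Reindexed by `Set.Iio δ'`, the
      -- chain `W α` becomes comparable to it under Φ7, which yields a common entry.
      obtain ⟨δ', ⟨e⟩⟩ := exists_posK_orderIso_theta s.top α
      have hW' := (hW α).comp_orderIso e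
      obtain ⟨l, hl⟩ := hw.exists_eq hW' (hG.labI_meet x _ δ δ' _ _ hw hW') i
      exact ⟨.labI α (e l), hl.symm⟩
  · intro p q h
    -- Equal images are related both ways, so `p` and `q` are related both ways; this leaves only
    -- pairs with the same constructor.
    have hpq := (hle p q).1 (h ▸ hG.refl _)
    have hqp := (hle q p).1 (h ▸ hG.refl _)
    cases hpq with
    | labII _ => exact congrArg _ (h₂.1.1 h)
    | labIII _ => exact congrArg _ ((h₃ _ _).1.1 h)
    | fork _ => exact congrArg _ (hyinj _ _ h)
    | fork_labI _ => cases hqp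
    | labI _ => exact congrArg _ ((hW _).2.2.2.1.1 h)

/-- The blocks are assembled along the tree of sequences. Comparisons inside a block are local,
those with a `Seq` point pass to the root, and distinct blocks are unrelated by uniqueness of roots.
-/
theorem nonempty_relIso_treePt {P : SuccSeq κ Two.{u} → SuccSeq κ (K κ) → Prop}
    (hP : ∀ u s x, IsSeqAt R C s x → (P u s ↔ ∃ z, IsLab R (leIII C u) x z)) :
    Nonempty (R ≃r (TreePt.Le : TreePt C P → TreePt C P → Prop)) := by
  choose x hx hxu using hG.exists_seqAt
  have hxS : ∀ s, IsSeq R (x s) := fun s => (hx s).isSeq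
  choose z hz using fun s => hG.exists_stem (x s) (hxS s)
  choose g hgr hgs hg using fun s => hG.exists_locPt_embedding (hx s) (hP · s (x s) (hx s))
  have hxle : ∀ s t, R (x s) (x t) ↔ s.IsPrefix t := fun s t =>
    hG.seqAt_le_iff _ _ s t (hx s) (hx t)
  have hroot : ∀ s t v w, IsRoot R (x s) v → IsRoot R (x t) w → R v w → s = t := by
    intro s t v w hv hw h
    have := hG.root_eq_of_le hv hw h
    exact hG.seqAt_unique (hx s) (this ▸ hx t)
  let f : TreePt C P → X := fun p => match p with
    | .seq s => x s
    | .stem s i => z s i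
    | .loc s p => g s p
  have hle : ∀ p q, R (f p) (f q) ↔ TreePt.Le p q := by
    intro p q
    constructor
    · intro h
      rcases p with s | ⟨s, i⟩ | ⟨s, p⟩ <;> rcases q with t | ⟨t, j⟩ | ⟨t, q⟩
      · exact .seq ((hxle _ _).1 h)
      · exact .seq_stem ((hxle _ _).1 ((hG.le_iff_le_root (hxS s) ((hz t).2.1 j)).1 h))
      · exact .seq_loc ((hxle _ _).1 ((hG.le_iff_le_root (hxS s) (hgr t q).1).1 h))
      · exact (hG.not_root_le_seq (hxS t) ((hz s).2.1 i) h).elim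
      · obtain rfl := hroot _ _ _ _ ((hz s).2.1 i) ((hz t).2.1 j) h
        exact .stem (((hz s).1.2 _ _).1 h)
      · obtain rfl := hroot _ _ _ _ ((hz s).2.1 i) (hgr t q).1 h
        exact .stem_loc
      · exact (hG.not_root_le_seq (hxS t) (hgr s p).1 h).elim
      · obtain rfl := hroot _ _ _ _ (hgr s p).1 ((hz t).2.1 j) h
        have := hG.stem_le (hz s) (hgr s p).1 (hgr s p).2 j
        exact (this.2 (hG.antisymm _ _ this.1 h)).elim
      · obtain rfl := hroot _ _ _ _ (hgr s p).1 (hgr t q).1 h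
        exact .loc (((hg s).2 _ _).1 h)
    · rintro (h | h | h | h | _ | h)
      · exact (hxle _ _).2 h
      · exact (hG.le_iff_le_root (hxS _) ((hz _).2.1 _)).2 ((hxle _ _).2 h)
      · exact (hG.le_iff_le_root (hxS _) (hgr _ _).1).2 ((hxle _ _).2 h)
      · exact ((hz _).1.2 _ _).2 h
      · exact (hG.stem_le (hz _) (hgr _ _).1 (hgr _ _).2 _).1
      · exact ((hg _).2 _ _).2 h
  have hinj : Function.Injective f := by
    intro p q h
    have hpq := (hle p q).1 (h ▸ hG.refl _)
    have hqp := (hle q p).1 (h ▸ hG.refl _)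
    cases hpq with
    | seq _ => exact congrArg _ (hG.seqAt_unique (hx _) ((show x _ = x _ from h) ▸ hx _))
    | seq_stem _ => cases hqp
    | seq_loc _ => cases hqp
    | stem _ => exact congrArg _ ((hz _).1.1 h)
    | stem_loc => cases hqp
    | loc _ => exact congrArg _ ((hg _).1 h)
  have hsurj : Function.Surjective f := by
    intro v
    rcases hG.exists_root v with hv | ⟨a, hv⟩
    · obtain ⟨s, hs⟩ := hG.seqAt_of_seq v hv
      exact ⟨.seq s, (hxu s v hs).symm⟩
    · obtain ⟨s, hs⟩ := hG.seqAt_of_seq a hv.1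
      obtain rfl := hxu s a hs
      by_cases hS : InStem R (x s) v
      · obtain ⟨i, rfl⟩ := (hG.inStem_iff (hz s)).1 hS
        exact ⟨.stem s i, rfl⟩
      · obtain ⟨p, rfl⟩ := hgs s v hv hS
        exact ⟨.loc s p, rfl⟩
  exact ⟨(RelIso.ofSurjective ⟨⟨f, hinj⟩, hle _ _⟩ hsurj).symm⟩

end IsGenTree

theorem nonempty_relIso_hasLabel [Fact κ.IsInaccessible] (A : Mod (Psi C)) :
    Nonempty (A.1 ≃r (TreePt.Le : TreePt C (fun u s => hMap C A (u, s) = true) → _ → Prop)) := by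
  have hG : IsGenTree A.1 C := isGenTree_of_realize C A.2
  refine hG.nonempty_relIso_treePt fun u s x hx => ?_
  simp only [hMap, decide_eq_true_eq, realize_HasLabel]
  refine ⟨fun h => h x hx, fun h y hy => ?_⟩
  -- `HasLabel` speaks of all points satisfying `Seq_s`; as there is only one, it is a statement
  -- about `x`.
  obtain ⟨x', -, hu⟩ := hG.exists_seqAt s
  rwa [hu y hy, ← hu x hx]

theorem reduces_hMap [Fact κ.IsInaccessible] : Reduces (IsomOn (Psi C)) (· = ·) (hMap C) := by
  intro A B
  constructor
  · rintro ⟨e⟩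
    funext ⟨u, s⟩
    simp only [hMap, decide_eq_decide]
    rw [← Formula.realize_relIso e,
      Subsingleton.elim (e ∘ PEmpty.elim) PEmpty.elim]
  · intro h
    obtain ⟨e⟩ := nonempty_relIso_hasLabel A
    obtain ⟨e'⟩ := nonempty_relIso_hasLabel B
    rw [h] at e
    exact ⟨e.trans e'.symm⟩

end Iso

end GenTree

theorem mainTheorem8 (κ : Cardinal.{u}) [Fact κ.IsInaccessible] (C : GenTree.LabelChoice κ) :
    GenTree.Reduces (GenTree.IsomOn (GenTree.Psi C)) (· = ·) (GenTree.hMap C) ∧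
      GenTree.IsSmooth (GenTree.Psi C) :=
  ⟨GenTree.reduces_hMap, GenTree.hMap C, GenTree.reduces_hMap⟩
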